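/- All data are $C^\infty$. Let $M$ be a smooth (finite-dimensional, Hausdorff, boundaryless) manifold and $m\ge 0$ an integer. A *regular semi-Hamiltonian quadruple* $(X,\mathcal V,\mathcal D,\sigma)$ on $M$ with $\operatorname{rk}\mathcal V=m$ consists of a vector field $X$, smooth distributions $\mathcal V\subset\mathcal D\subset TM$ of ranks $m$ and $2m$, and a smooth non-degenerate skew-symmetric 2-form $\sigma$ on $\mathcal D$, such that - $[X,\mathcal D]\subset\mathcal D$, and $X(\sigma(Y,Z))=\sigma([X,Y],Z)+\sigma(Y,[X,Z])$ for all local sections $Y,Z$ of $\mathcal D$; - $\mathcal V$ is Lagrangian: $\sigma_x(v,w)=0$ for all $v,w\in\mathcal V(x)$, $x\in M$; - $X(x)\neq 0$ for all $x\in M$, and $\mathcal V+[X,\mathcal V]$ (spanned by the values of local sections $V$ of $\mathcal V$ and of the brackets $[X,V]$) has rank $2m$ everywhere, hence equals $\mathcal D$. The *canonical metric* on $\mathcal V$ is the bilinear form $g(V,W)=\sigma([X,V],W)$, $V,W\in\mathcal V$, which is tensorial. The *curvature operator* $K_x:\mathcal V(x)\to\mathcal V(x)$ is defined as follows: if $V_1,\dots,V_m$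 is a local frame of $\mathcal V$ around $x$ and $$[X,[X,V_j]]=\sum_i (H_0)^i_jV_i+\sum_i(H_1)^i_j[X,V_i],$$ then $K_x$ has, in the basis $V_1(x),\dots,V_m(x)$, the matrix $-H_0+\tfrac12X(H_1)-\tfrac14H_1^2$ evaluated at $x$; it does not depend on the frame. If $c$ is an integral curve of $X$ starting at time $0$, then $t^*>0$ in its domain is a *conjugate time*, and $c(t^*)$ a *conjugate point* to $c(0)$ on $c$, if $$\exp(t^*X)_*\mathcal V(c(0))\cap\mathcal V(c(t^*))\neq\{0\},$$ where $\exp(tX)$ is the (local) flow of $X$. **Theorem.** Let $(X,\mathcal V,\mathcal D,\sigma)$ be a regular semi-Hamiltonian quadruple on $M$ and let $c:[0,T)\to M$, $T\in(0,\infty]$, be an integral curve of $X$. Assume that the canonical metric $g$ is definite (positive or negative) on $\mathcal V(c(t))$ for every $t\in[0,T)$, and that there is a constant $\kappa>0$ with $\operatorname{tr}K_{c(t)}\ge\kappa$ for all $t\in[0,T)$. Put $$T^*=\frac{\pi\,\operatorname{rk}\mathcal V}{\sqrt\kappa}.$$ If $T^*<T$, then there is a conjugate time in $(0,T^*]$.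 -/

import Mathlib

open scoped Manifold ContDiff

noncomputable section

namespace DynamicPair

variable {E : Type*} [NormedAddCommGroup E] [NormedSpace ℝ E]
  {M : Type*} [TopologicalSpace M] [ChartedSpace E M] [IsManifold 𝓘(ℝ, E) ∞ M]

/-- The vector field `Y` is `C^∞` on the set `U` (its values outside `U` are irrelevant). -/
def IsSmoothOn (Y : ∀ x : M, TangentSpace 𝓘(ℝ, E) x) (U : Set M) : Prop :=
  ContMDiffOn 𝓘(ℝ, E) 𝓘(ℝ, E).tangent ∞
    (fun x => (⟨x, Y x⟩ : TangentBundle 𝓘(ℝ, E) M)) U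

/-- The vector field underlying a (set-theoretic) section of a field of tangent planes. A local
section over an open set `U` is such a section which is smooth on `U`; its values outside `U`
play no role. -/
def toField {𝒱 : ∀ x : M, Submodule ℝ (TangentSpace 𝓘(ℝ, E) x)} (V : ∀ x, 𝒱 x) :
    ∀ x : M, TangentSpace 𝓘(ℝ, E) x :=
  fun x => (V x : TangentSpace 𝓘(ℝ, E) x)

/-- `V₁, …, V_m` is a smooth frame of the field of planes `𝒱` on `U`. -/
structure IsFrameOn {m : ℕ} (𝒱 : ∀ x : M, Submodule ℝ (TangentSpace 𝓘(ℝ, E) x))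
    (V : Fin m → ∀ x, 𝒱 x) (U : Set M) : Prop where
  smooth : ∀ i, IsSmoothOn (toField (V i)) U
  linearIndependent : ∀ x ∈ U, LinearIndependent ℝ (fun i => V i x)
  span_eq_top : ∀ x ∈ U, Submodule.span ℝ (Set.range fun i => V i x) = ⊤

/-- `𝒱` is a smooth distribution of rank `m`: it has smooth local frames with `m` elements. -/
def IsDistribution (m : ℕ) (𝒱 : ∀ x : M, Submodule ℝ (TangentSpace 𝓘(ℝ, E) x)) : Prop :=
  ∀ x : M, ∃ U : Set M, IsOpen U ∧ x ∈ U ∧ ∃ V : Fin m → ∀ y, 𝒱 y, IsFrameOn 𝒱 V U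

/-- The Lie bracket `[X, Y]` of vector fields. -/
abbrev bracket (X Y : ∀ x : M, TangentSpace 𝓘(ℝ, E) x) : ∀ x : M, TangentSpace 𝓘(ℝ, E) x :=
  VectorField.mlieBracket 𝓘(ℝ, E) X Y

/-- The derivative `X(f)` of a function `f` in the direction of the vector field `X`. -/
def derivAlong (X : ∀ x : M, TangentSpace 𝓘(ℝ, E) x) (f : M → ℝ) (x : M) : ℝ :=
  mfderiv 𝓘(ℝ, E) 𝓘(ℝ, ℝ) f x (X x)

/-- The field of planes `𝒱 + [X, 𝒱]`: at `x` it is spanned by `𝒱(x)` and the values at `x` of the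
brackets `[X, V]`, where `V` runs through the local sections of `𝒱` around `x`. -/
def bracketSum (X : ∀ x : M, TangentSpace 𝓘(ℝ, E) x)
    (𝒱 : ∀ x : M, Submodule ℝ (TangentSpace 𝓘(ℝ, E) x)) (x : M) :
    Submodule ℝ (TangentSpace 𝓘(ℝ, E) x) :=
  𝒱 x ⊔ Submodule.span ℝ {w | ∃ U : Set M, IsOpen U ∧ x ∈ U ∧ ∃ V : ∀ y, 𝒱 y,
    IsSmoothOn (toField V) U ∧ w = bracket X (toField V) x}

/-- A linear operator `K` on `𝒱(x)` is the curvature operator of `(X, 𝒱)` at `x` if there are a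
smooth frame `V = (V₁, …, V_m)` of `𝒱` around `x` and matrices of functions `H₀`, `H₁` with
`[X, [X, V_j]] = ∑ᵢ (H₀)ᵢⱼ Vᵢ + ∑ᵢ (H₁)ᵢⱼ [X, Vᵢ]`
around `x`, such that `K` has the matrix `-H₀ + (1/2) X(H₁) - (1/4) H₁²` in the basis `V(x)`. -/
def IsCurvatureAt (X : ∀ x : M, TangentSpace 𝓘(ℝ, E) x)
    (𝒱 : ∀ x : M, Submodule ℝ (TangentSpace 𝓘(ℝ, E) x)) (x : M)
    (K : 𝒱 x →ₗ[ℝ] 𝒱 x) : Prop :=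
  ∃ (m : ℕ) (U : Set M) (V : Fin m → ∀ y, 𝒱 y) (H₀ H₁ : M → Matrix (Fin m) (Fin m) ℝ),
    IsOpen U ∧ x ∈ U ∧ IsFrameOn 𝒱 V U ∧
    (∀ y ∈ U, ∀ j, bracket X (bracket X (toField (V j))) y =
      ∑ i, H₀ y i j • toField (V i) y + ∑ i, H₁ y i j • bracket X (toField (V i)) y) ∧
    ∀ j, K (V j x) = ∑ i, (-H₀ x
      + (1 / 2 : ℝ) • Matrix.of (fun a b => derivAlong X (fun y => H₁ y a b) x)
      - (1 / 4 : ℝ) • (H₁ x * H₁ x)) i j • V i x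

open Classical in
/-- The curvature operator `K_x : 𝒱(x) → 𝒱(x)` of `(X, 𝒱)`. For a regular pair the operator in
`IsCurvatureAt` exists and does not depend on the frame; the value `0` is never used then. -/
def curvature (X : ∀ x : M, TangentSpace 𝓘(ℝ, E) x)
    (𝒱 : ∀ x : M, Submodule ℝ (TangentSpace 𝓘(ℝ, E) x)) (x : M) : 𝒱 x →ₗ[ℝ] 𝒱 x :=
  if h : ∃ K : 𝒱 x →ₗ[ℝ] 𝒱 x, IsCurvatureAt X 𝒱 x K then h.choose else 0

open Classical in
/-- The flow `exp(tX)`, `t ≥ 0`: the point `y` goes to `γ(t)`, where `γ : [0, t] → M` is the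
integral curve of `X` with `γ(0) = y`; if there is none, the value is the junk value `y`. -/
def flow (X : ∀ x : M, TangentSpace 𝓘(ℝ, E) x) (t : ℝ) (y : M) : M :=
  if h : ∃ γ : ℝ → M, γ 0 = y ∧ IsMIntegralCurveOn γ X (Set.Icc 0 t) then h.choose t else y

/-- `t > 0` is a conjugate time, and `c(t)` a conjugate point to `c(0)`, on the integral curve `c`
of `X`: `exp(tX)_* 𝒱(c(0)) ∩ 𝒱(c(t)) ≠ {0}`. Here `c(t)` is written `exp(tX)(c(0))`. -/
def IsConjugateTime (X : ∀ x : M, TangentSpace 𝓘(ℝ, E) x)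
    (𝒱 : ∀ x : M, Submodule ℝ (TangentSpace 𝓘(ℝ, E) x)) (c : ℝ → M) (t : ℝ) : Prop :=
  0 < t ∧
    (𝒱 (c 0)).map (mfderiv 𝓘(ℝ, E) 𝓘(ℝ, E) (flow X t) (c 0)).toLinearMap ⊓
      𝒱 (flow X t (c 0)) ≠ ⊥

variable (E M) in
/-- A regular semi-Hamiltonian quadruple `(X, 𝒱, 𝒟, σ)` on `M` with `rk 𝒱 = m`. -/
structure RegularSemiHamiltonianQuadruple (m : ℕ) where
  /-- the vector field -/
  X : ∀ x : M, TangentSpace 𝓘(ℝ, E) x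
  /-- the distribution `𝒱` -/
  𝒱 : ∀ x : M, Submodule ℝ (TangentSpace 𝓘(ℝ, E) x)
  /-- the distribution `𝒟` -/
  𝒟 : ∀ x : M, Submodule ℝ (TangentSpace 𝓘(ℝ, E) x)
  /-- the 2-form on `𝒟` -/
  σ : ∀ x : M, LinearMap.BilinForm ℝ (𝒟 x)
  smooth_X : IsSmoothOn X Set.univ
  distribution_𝒱 : IsDistribution m 𝒱
  distribution_𝒟 : IsDistribution (2 * m) 𝒟
  smooth_σ : ∀ U : Set M, IsOpen U → ∀ Y Z : ∀ x, 𝒟 x,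
    IsSmoothOn (toField Y) U → IsSmoothOn (toField Z) U →
      ContMDiffOn 𝓘(ℝ, E) 𝓘(ℝ, ℝ) ∞ (fun x => σ x (Y x) (Z x)) U
  alt_σ : ∀ x, (σ x).IsAlt
  nondegenerate_σ : ∀ x, (σ x).Nondegenerate
  /-- (I): `[X, 𝒟] ⊆ 𝒟` -/
  bracket_mem : ∀ U : Set M, IsOpen U → ∀ Y : ∀ x, 𝒟 x, IsSmoothOn (toField Y) U →
    ∀ x ∈ U, bracket X (toField Y) x ∈ 𝒟 x
  /-- (S): `X(σ(Y, Z)) = σ([X, Y], Z) + σ(Y, [X, Z])` -/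
  invariant_σ : ∀ (U : Set M) (hU : IsOpen U) (Y Z : ∀ x, 𝒟 x)
    (hY : IsSmoothOn (toField Y) U) (hZ : IsSmoothOn (toField Z) U) (x : M) (hx : x ∈ U),
    derivAlong X (fun y => σ y (Y y) (Z y)) x =
      σ x ⟨bracket X (toField Y) x, bracket_mem U hU Y hY x hx⟩ (Z x) +
      σ x (Y x) ⟨bracket X (toField Z) x, bracket_mem U hU Z hZ x hx⟩
  𝒱_le_𝒟 : ∀ x, 𝒱 x ≤ 𝒟 x
  /-- (L): `𝒱` is Lagrangian -/
  lagrangian : ∀ x, ∀ v w : 𝒱 x, σ x ⟨v, 𝒱_le_𝒟 x v.2⟩ ⟨w, 𝒱_le_𝒟 x w.2⟩ = 0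
  /-- (R1) -/
  X_ne_zero : ∀ x, X x ≠ 0
  /-- (R2): `𝒱 + [X, 𝒱]` has rank `2m` -/
  finrank_bracketSum : ∀ x, Module.finrank ℝ (bracketSum X 𝒱 x) = 2 * m

namespace RegularSemiHamiltonianQuadruple

variable {m : ℕ} (Q : RegularSemiHamiltonianQuadruple E M m)

/-- A section of `𝒱` regarded as a section of `𝒟`. -/
def incl (V : ∀ x, Q.𝒱 x) : ∀ x, Q.𝒟 x := fun x => ⟨V x, Q.𝒱_le_𝒟 x (V x).2⟩

/-- The canonical metric `g(V, W) = σ([X, V], W)`, evaluated at `x ∈ U` on sections `V`, `W` of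
`𝒱`, where `V` is smooth on the open set `U`. -/
def metric {U : Set M} (hU : IsOpen U) (V W : ∀ y, Q.𝒱 y) (hV : IsSmoothOn (toField V) U)
    {x : M} (hx : x ∈ U) : ℝ :=
  Q.σ x ⟨bracket Q.X (toField V) x, Q.bracket_mem U hU (Q.incl V) hV x hx⟩ (Q.incl W x)

/-- The canonical metric is positive definite at `x`. -/
def MetricPosDefAt (x : M) : Prop :=
  ∀ (U : Set M) (hU : IsOpen U) (hx : x ∈ U) (V : ∀ y, Q.𝒱 y) (hV : IsSmoothOn (toField V) U),
    V x ≠ 0 → 0 < Q.metric hU V V hV hx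

/-- The canonical metric is negative definite at `x`. -/
def MetricNegDefAt (x : M) : Prop :=
  ∀ (U : Set M) (hU : IsOpen U) (hx : x ∈ U) (V : ∀ y, Q.𝒱 y) (hV : IsSmoothOn (toField V) U),
    V x ≠ 0 → Q.metric hU V V hV hx < 0

end RegularSemiHamiltonianQuadruple

end DynamicPair

end

/-! Pull everything back along `c` to the fixed space at `c 0`. With `P t` the derivative of the
flow and `R t` its inverse, `s ↦ R s (𝒱 (c s))` is a curve of Lagrangian subspaces of `𝒟 (c 0)`,
because the flow preserves `𝒟` and `σ` (`transport_mem_planeD`, `form_transport`). Differentiating a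
pulled back field amounts to taking its bracket with `X` (`exists_transport`), so a frame `V` of `𝒱`
becomes a moving frame `e` with `e'' = e H₀ + e' H₁`, and the canonical metric becomes `g = σ(e',
e)`.

Let `v` be a basis of `𝒱 (c 0)` and `A(s) = σ(v, e(s))`. Since `𝒱 (c 0)` is Lagrangian, `A(s)` is
singular for some `s > 0` exactly when `s` is a conjugate time. Moreover `A'' = A H₀ + A' H₁`. Put
`N = H₁ - 2 A⁻¹ A'` and `h = tr N`. Wherever `A` is invertible, completing a square gives `h' = 2 tr
K + (1/2) tr N²`. The skew part of `g H₁` and twice that of `g A⁻¹ A'` are the same form `σ(e', e')`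
up to a common factor, so `g N` is symmetric. As `g` is definite, `tr N² ≥ h² / m`, hence `h' ≥ 2 κ
+ h² / (2 m)`.

Without conjugate times this Riccati inequality would hold on all of `(0, π m / √κ]`. But `arctan (h
/ (2 m k))` with `k = √(κ / m)` grows at least at rate `k`, so it would gain `π √m ≥ π` there, more
than the range of `arctan` allows (`riccati_blowup`). The frames exist only locally; `frameTrace_eq`
shows that `h` does not depend on them, which makes the argument global (`false_of_frames`). -/

namespace DynamicPair

open Set Metric Topology NNReal

/-! ### Differentiability of local flows in the initial point -/

section LocalFlow

variable {F : Type*} [NormedAddCommGroup F] [NormedSpace ℝ F]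

/-- The Picard-Lindelöf local flow stays in the ball on which the vector field is controlled. -/
theorem exists_localFlow_mem_closedBall [CompleteSpace F] {f : ℝ → F → F} {tmin tmax : ℝ} {t₀ : Icc tmin tmax}
    {x₀ : F} {a r L K : ℝ≥0} (hf : IsPicardLindelof f t₀ x₀ a r L K) :
    ∃ α : F → ℝ → F, ∀ x ∈ closedBall x₀ r, α x t₀ = x ∧ ∀ t ∈ Icc tmin tmax,
      α x t ∈ closedBall x₀ a ∧ HasDerivWithinAt (α x) (f t (α x t)) (Icc tmin tmax) t := by
  classical
  have key : ∀ x : F, ∃ α : ℝ → F, x ∈ closedBall x₀ r → α t₀ = x ∧ ∀ t ∈ Icc tmin tmax,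
      α t ∈ closedBall x₀ a ∧ HasDerivWithinAt α (f t (α t)) (Icc tmin tmax) t := by
    intro x
    by_cases hx : x ∈ closedBall x₀ r
    · obtain ⟨α, hα⟩ := ODE.FunSpace.exists_isFixedPt_next hf hx
      refine ⟨α.compProj, fun _ => ⟨by rw [ODE.FunSpace.compProj_val, ← hα,
        ODE.FunSpace.next_apply₀], fun t ht ↦ ⟨α.compProj_mem_closedBall hf.mul_max_le, ?_⟩⟩⟩
      apply ODE.hasDerivWithinAt_picard_Icc t₀.2 hf.continuousOn_uncurry
        α.continuous_compProj.continuousOn (fun _ ht' ↦ α.compProj_mem_closedBall hf.mul_max_le)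
        x ht |>.congr_of_mem _ ht
      intro t' ht'
      nth_rw 1 [← hα]
      rw [ODE.FunSpace.compProj_of_mem ht', ODE.FunSpace.next_apply]
    · exact ⟨fun _ => 0, fun h => absurd h hx⟩
  choose α hα using key
  exact ⟨α, hα⟩

theorem gronwallBound_zero_eq_mul (K ε x : ℝ) :
    gronwallBound 0 K ε x = ε * gronwallBound 0 K 1 x := by
  unfold gronwallBound
  split_ifs <;> ring

/-- Quadratic error of the first order approximation of a map whose derivative is Lipschitz. -/
theorem norm_sub_sub_fderiv_le {f : F → F} {s : Set F} (hs : Convex ℝ s) {C : ℝ≥0}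
    (hd : ∀ x ∈ s, DifferentiableAt ℝ f x) (hC : LipschitzOnWith C (fderiv ℝ f) s)
    {x k : F} (hx : x ∈ s) (hxk : x + k ∈ s) :
    ‖f (x + k) - f x - fderiv ℝ f x k‖ ≤ C * ‖k‖ ^ 2 := by
  have hseg : segment ℝ x (x + k) ⊆ s := hs.segment_subset hx hxk
  have h := (convex_segment x (x + k)).norm_image_sub_le_of_norm_hasFDerivWithin_le'
    (f := f) (f' := fderiv ℝ f) (φ := fderiv ℝ f x) (C := C * ‖k‖)
    (fun z hz => (hd z (hseg hz)).hasFDerivAt.hasFDerivWithinAt)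
    (fun z hz => by
      have h1 := hC.norm_sub_le (hseg hz) hx
      refine h1.trans ?_
      gcongr
      have := norm_sub_le_of_mem_segment hz
      simpa using this)
    (left_mem_segment ℝ x (x + k)) (right_mem_segment ℝ x (x + k))
  simpa [pow_two, mul_assoc] using h

/-- A smooth vector field has a local flow which is differentiable in the initial point; the
derivative solves the variational equation. -/
theorem exists_localFlow_hasFDerivAt [CompleteSpace F] {f : F → F} {x₀ : F} (hf : ContDiffAt ℝ 2 f x₀)
    {u : Set F} (hu : u ∈ 𝓝 x₀) :
    ∃ r > 0, ∃ δ > 0, ∃ (φ : F → ℝ → F) (L : F → ℝ → F →L[ℝ] F), ∀ y ∈ ball x₀ r,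
      φ y 0 = y ∧ L y 0 = ContinuousLinearMap.id ℝ F ∧ ∀ τ ∈ Ioo (-δ) δ,
        φ y τ ∈ u ∧ HasDerivAt (φ y) (f (φ y τ)) τ ∧
        HasDerivAt (L y) ((fderiv ℝ f (φ y τ)).comp (L y τ)) τ ∧
        ‖L y τ - ContinuousLinearMap.id ℝ F‖ ≤ 1 / 2 ∧
        HasFDerivAt (fun z => φ z τ) (L y τ) y := by
  have hf1 : ContDiffAt ℝ 1 f x₀ := hf.of_le (by norm_num)
  have hdf : ContDiffAt ℝ 1 (fderiv ℝ f) x₀ := hf.fderiv_right (by norm_num)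
  obtain ⟨K, s₁, hs₁, hK⟩ := hf1.exists_lipschitzOnWith
  obtain ⟨C, s₂, hs₂, hC⟩ := hdf.exists_lipschitzOnWith
  have hd : ∀ᶠ x in 𝓝 x₀, DifferentiableAt ℝ f x :=
    (hf1.eventually (by simp)).mono fun x hx => hx.differentiableAt (by norm_num)
  obtain ⟨ρ, hρ, hball⟩ := Metric.mem_nhds_iff.mp
    (Filter.inter_mem (Filter.inter_mem hs₁ hs₂) (Filter.inter_mem hu hd))
  have hB1 : ball x₀ ρ ⊆ s₁ := fun x hx => (hball hx).1.1
  have hB2 : ball x₀ ρ ⊆ s₂ := fun x hx => (hball hx).1.2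
  have hBu : ball x₀ ρ ⊆ u := fun x hx => (hball hx).2.1
  have hBd : ∀ x ∈ ball x₀ ρ, DifferentiableAt ℝ f x := fun x hx => (hball hx).2.2
  set I₁ := ContinuousLinearMap.id ℝ F
  -- The equation and its variational equation form one autonomous system. It is `C¹` because `f` is
  -- `C²`, so Picard-Lindelöf yields the flow and its candidate derivative together.
  let G : F × (F →L[ℝ] F) → F × (F →L[ℝ] F) := fun p => (f p.1, (fderiv ℝ f p.1).comp p.2)
  have hG : ContDiffAt ℝ 1 G (x₀, I₁) := by
    refine ContDiffAt.prodMk (ContDiffAt.comp (x₀, I₁) hf1 contDiffAt_fst) ?_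
    exact ContDiffAt.clm_comp (ContDiffAt.comp (x₀, I₁) hdf contDiffAt_fst) contDiffAt_snd
  obtain ⟨ε, hε, a, r, L, K', hr, hpl⟩ := IsPicardLindelof.of_contDiffAt_one hG
  have ha0 : 0 < a := by
    have h1 := (hpl 0).mul_max_le
    have h2 : (0 : ℝ) ≤ L * max (0 + ε - 0) (0 - (0 - ε)) := by
      have : 0 ≤ max (0 + ε - 0) (0 - (0 - ε)) := le_max_of_le_left (by linarith)
      positivity
    have h3 : (0 : ℝ) < r := hr
    have : (0 : ℝ) < a := by
      have := h2.trans h1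
      linarith
    exact this
  -- The bound `1 / 2` keeps the linear part invertible, with `‖L h‖ ≤ 2 ‖h‖`. The bound `ρ / 4`
  -- keeps `φ + L h` in the ball of radius `ρ` when `‖h‖ < ρ / 4`, since `ρ / 4 + 2 ρ / 4 < ρ`.
  let a' : ℝ≥0 := min a (min (1 / 2) ⟨ρ / 4, by positivity⟩)
  have ha' : 0 < a' := by
    refine lt_min ha0 (lt_min (by norm_num) ?_)
    have : (0 : ℝ) < ρ / 4 := by positivity
    exact this
  have ha'1 : (a' : ℝ) ≤ 1 / 2 := by
    have : a' ≤ 1 / 2 := (min_le_right _ _).trans (min_le_left _ _)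
    exact_mod_cast this
  have ha'2 : (a' : ℝ) ≤ ρ / 4 := by
    have : a' ≤ ⟨ρ / 4, by positivity⟩ := (min_le_right _ _).trans (min_le_right _ _)
    exact this
  obtain ⟨ε', hε', hpl'⟩ := (hpl 0).exists_shrink_radius hε (a' := a') (r' := a' / 2)
    (min_le_left _ _) (half_lt_self ha'.ne')
  obtain ⟨α, hα⟩ := exists_localFlow_mem_closedBall hpl'
  have ha'r : (0 : ℝ) < a' / 2 := by
    have : (0 : ℝ) < a' := ha'
    positivity
  have main : ∀ y ∈ ball x₀ (a' / 2 : ℝ), α (y, I₁) 0 = (y, I₁) ∧ ∀ t ∈ Icc (-ε') ε',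
      (α (y, I₁) t).1 ∈ closedBall x₀ a' ∧ ‖(α (y, I₁) t).2 - I₁‖ ≤ 1 / 2 ∧
      HasDerivWithinAt (α (y, I₁)) (G (α (y, I₁) t)) (Icc (-ε') ε') t := by
    intro y hy
    have hy' : (y, I₁) ∈ closedBall (x₀, I₁) ((a' / 2 : ℝ≥0) : ℝ) := by
      rw [mem_closedBall, Prod.dist_eq, dist_self]
      have : dist y x₀ < a' / 2 := hy
      push_cast
      exact max_le this.le ha'r.le
    obtain ⟨h0, h1⟩ := hα _ hy'
    refine ⟨h0, fun t ht => ?_⟩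
    have ht' : t ∈ Icc (0 - ε') (0 + ε') := by simpa using ht
    obtain ⟨h2, h3⟩ := h1 t ht'
    rw [mem_closedBall, Prod.dist_eq, max_le_iff] at h2
    refine ⟨h2.1, ?_, by simpa using h3⟩
    rw [← dist_eq_norm]
    exact h2.2.trans ha'1
  have mainD : ∀ y ∈ ball x₀ (a' / 2 : ℝ), ∀ t ∈ Ioo (-ε') ε',
      HasDerivAt (fun t => (α (y, I₁) t).1) (f (α (y, I₁) t).1) t ∧
      HasDerivAt (fun t => (α (y, I₁) t).2)
        ((fderiv ℝ f (α (y, I₁) t).1).comp (α (y, I₁) t).2) t := by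
    intro y hy t ht
    have h := ((main y hy).2 t (Ioo_subset_Icc_self ht)).2.2.hasDerivAt (Icc_mem_nhds ht.1 ht.2)
    have h1 := (hasFDerivAt_fst (𝕜 := ℝ) (E := F) (F := F →L[ℝ] F)
      (p := α (y, I₁) t)).comp_hasDerivAt t h
    have h2 := (hasFDerivAt_snd (𝕜 := ℝ) (E := F) (F := F →L[ℝ] F)
      (p := α (y, I₁) t)).comp_hasDerivAt t h
    exact ⟨h1, h2⟩
  have hLn : ∀ y ∈ ball x₀ (a' / 2 : ℝ), ∀ t ∈ Icc (-ε') ε', ∀ h : F,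
      ‖(α (y, I₁) t).2 h‖ ≤ 2 * ‖h‖ := by
    intro y hy t ht h
    have h1 := ((main y hy).2 t ht).2.1
    have h2 : ‖((α (y, I₁) t).2 - I₁) h‖ ≤ 1 / 2 * ‖h‖ :=
      (ContinuousLinearMap.le_opNorm _ _).trans (by gcongr)
    have h3 : (α (y, I₁) t).2 h = ((α (y, I₁) t).2 - I₁) h + h := by simp [I₁]
    rw [h3]
    have := norm_add_le (((α (y, I₁) t).2 - I₁) h) h
    have := norm_nonneg h
    linarith
  have hsub : closedBall x₀ (a' : ℝ) ⊆ ball x₀ ρ :=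
    closedBall_subset_ball (by linarith)
  refine ⟨a' / 2, ha'r, ε', hε', fun y t => (α (y, I₁) t).1, fun y t => (α (y, I₁) t).2,
    fun y hy => ⟨by simp [(main y hy).1], by simp [(main y hy).1], fun τ hτ => ⟨?_, (mainD y hy τ hτ).1,
      (mainD y hy τ hτ).2, ((main y hy).2 τ (Ioo_subset_Icc_self hτ)).2.1, ?_⟩⟩⟩
  · exact hBu (hsub ((main y hy).2 τ (Ioo_subset_Icc_self hτ)).1)
  -- the estimate by Grönwall's inequality, in either time direction
  obtain ⟨e, he, hτe⟩ : ∃ e : ℝ, e * e = 1 ∧ e * τ = |τ| := by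
    rcases le_total 0 τ with h | h
    · exact ⟨1, by norm_num, by rw [abs_of_nonneg h]; ring⟩
    · exact ⟨-1, by norm_num, by rw [abs_of_nonpos h]; ring⟩
  have heabs : |e| = 1 := by
    have : |e| * |e| = 1 := by rw [← abs_mul, he, abs_one]
    nlinarith [abs_nonneg e]
  have hτ' : |τ| < ε' := abs_lt.mpr hτ
  have het : ∀ t ∈ Icc 0 |τ|, e * t ∈ Ioo (-ε') ε' := by
    intro t ht
    rw [mem_Ioo, ← abs_lt, abs_mul, heabs, one_mul, abs_of_nonneg ht.1]
    exact ht.2.trans_lt hτ'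
  have hback : e * |τ| = τ := by rw [← hτe, ← mul_assoc, he, one_mul]
  set B : ℝ := 4 * C * gronwallBound 0 K 1 |τ|
  have hest : ∀ h : F, y + h ∈ ball x₀ (a' / 2 : ℝ) → ‖h‖ < ρ / 4 →
      ‖(α (y + h, I₁) τ).1 - (α (y, I₁) τ).1 - (α (y, I₁) τ).2 h‖ ≤ B * ‖h‖ ^ 2 := by
    intro h hyh hh
    have hd1 : ∀ z ∈ ball x₀ (a' / 2 : ℝ), ∀ t ∈ Icc 0 |τ|,
        HasDerivAt (fun t => (α (z, I₁) (e * t)).1) (e • f (α (z, I₁) (e * t)).1) t := by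
      intro z hz t ht
      have h1 : HasDerivAt (fun t => e * t) e t := by simpa using (hasDerivAt_id t).const_mul e
      exact HasDerivAt.scomp t (mainD z hz _ (het t ht)).1 h1
    have hd2 : ∀ t ∈ Icc 0 |τ|, HasDerivAt (fun t => (α (y, I₁) (e * t)).2 h)
        (e • fderiv ℝ f (α (y, I₁) (e * t)).1 ((α (y, I₁) (e * t)).2 h)) t := by
      intro t ht
      have h1 : HasDerivAt (fun t => e * t) e t := by simpa using (hasDerivAt_id t).const_mul e
      have h2 := HasDerivAt.scomp t (mainD y hy _ (het t ht)).2 h1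
      have h3 := h2.clm_apply (hasDerivAt_const t h)
      simpa using h3
    have hg := fun t ht => (hd1 y hy t ht).add (hd2 t ht)
    have hin : ∀ z ∈ ball x₀ (a' / 2 : ℝ), ∀ t ∈ Icc 0 |τ|,
        (α (z, I₁) (e * t)).1 ∈ closedBall x₀ (a' : ℝ) := fun z hz t ht =>
      ((main z hz).2 _ (Ioo_subset_Icc_self (het t ht))).1
    have hgin : ∀ t ∈ Icc 0 |τ|,
        (α (y, I₁) (e * t)).1 + (α (y, I₁) (e * t)).2 h ∈ ball x₀ ρ := by
      intro t ht
      have h1 := hin y hy t ht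
      have h2 := hLn y hy _ (Ioo_subset_Icc_self (het t ht)) h
      rw [mem_closedBall, dist_eq_norm] at h1
      rw [mem_ball, dist_eq_norm, add_sub_right_comm]
      refine (norm_add_le _ _).trans_lt ?_
      linarith
    have hnorm : ∀ v : F, ‖e • v‖ = ‖v‖ := fun v => by
      rw [norm_smul, Real.norm_eq_abs, heabs, one_mul]
    -- The linearised curve `φ(y) + L(y) h` solves the equation up to an error `C (2 ‖h‖)²` and
    -- starts at `y + h`. Grönwall then bounds its distance to the true trajectory by a multiple of
    -- `‖h‖²`, which gives differentiability.
    have := dist_le_of_approx_trajectories_ODE_of_mem (a := 0) (b := |τ|) (K := K)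
      (v := fun _ x => e • f x) (s := fun _ => ball x₀ ρ) (εf := 0) (εg := C * (2 * ‖h‖) ^ 2) (δ := 0)
      (fun t _ => by
        refine LipschitzOnWith.of_dist_le_mul fun x hx z hz => ?_
        rw [dist_eq_norm, ← smul_sub, hnorm, ← dist_eq_norm]
        exact hK.dist_le_mul x (hB1 hx) z (hB1 hz))
      (fun t ht => (hd1 (y + h) hyh t ht).continuousAt.continuousWithinAt)
      (fun t ht => (hd1 (y + h) hyh t (Ico_subset_Icc_self ht)).hasDerivWithinAt)
      (fun t ht => by rw [dist_self])
      (fun t ht => hsub (hin _ hyh t (Ico_subset_Icc_self ht)))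
      (fun t ht => (hg t ht).continuousAt.continuousWithinAt)
      (fun t ht => (hg t (Ico_subset_Icc_self ht)).hasDerivWithinAt)
      (fun t ht => by
        have ht' := Ico_subset_Icc_self ht
        have h1 := norm_sub_sub_fderiv_le (convex_ball x₀ ρ) hBd (hC.mono hB2)
          (hsub (hin y hy t ht')) (hgin t ht')
        have h2 := hLn y hy _ (Ioo_subset_Icc_self (het t ht')) h
        rw [dist_comm, dist_eq_norm]
        simp only [Pi.add_apply]
        rw [← smul_add, ← smul_sub, hnorm, ← sub_sub]
        exact h1.trans (by gcongr))
      (fun t ht => hgin t (Ico_subset_Icc_self ht))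
      (by simp [(main y hy).1, (main (y + h) hyh).1, I₁])
      |τ| ⟨abs_nonneg τ, le_rfl⟩
    simp only [Pi.add_apply] at this
    rw [hback, dist_eq_norm, ← sub_sub] at this
    refine this.trans ?_
    rw [sub_zero, zero_add, gronwallBound_zero_eq_mul]
    simp only [B]
    nlinarith
  rw [hasFDerivAt_iff_isLittleO_nhds_zero]
  have hO : (fun h : F => (α (y + h, I₁) τ).1 - (α (y, I₁) τ).1 - (α (y, I₁) τ).2 h)
      =O[𝓝 0] fun h : F => ‖h‖ ^ 2 := by
    refine Asymptotics.IsBigO.of_bound B ?_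
    have h1 : ∀ᶠ h : F in 𝓝 0, y + h ∈ ball x₀ (a' / 2 : ℝ) := by
      have : Filter.Tendsto (fun h : F => y + h) (𝓝 0) (𝓝 y) := by
        have : Continuous fun h : F => y + h := by fun_prop
        simpa using this.tendsto 0
      exact this (isOpen_ball.mem_nhds hy)
    have h2 : ∀ᶠ h : F in 𝓝 0, ‖h‖ < ρ / 4 := by
      filter_upwards [ball_mem_nhds (0 : F) (show 0 < ρ / 4 by positivity)] with h hh
      simpa using hh
    filter_upwards [h1, h2] with h hh1 hh2
    simpa using hest h hh1 hh2
  exact hO.trans_isLittleO (by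
    have := Asymptotics.isLittleO_norm_pow_id (E' := F) (n := 2) (by norm_num)
    simpa using this)

end LocalFlow

end DynamicPair

namespace DynamicPair
open Set Metric Topology NNReal VectorField Filter

/-! ### Vector fields and brackets in a chart -/

section Chart
variable {E : Type*} [NormedAddCommGroup E] [NormedSpace ℝ E]
  {M : Type*} [TopologicalSpace M] [ChartedSpace E M]

/-- The vector field `Y` read in the chart around `x₀`. -/
noncomputable def chartField (x₀ : M) (Y : ∀ x : M, TangentSpace 𝓘(ℝ, E) x) : E → E :=
  mpullbackWithin 𝓘(ℝ, E) 𝓘(ℝ, E) (extChartAt 𝓘(ℝ, E) x₀).symm Y (range 𝓘(ℝ, E))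

/-- The derivative of the inverse of the chart around `x₀`. -/
noncomputable def chartSymmDeriv (x₀ : M) (z : E) : E →L[ℝ] E :=
  mfderivWithin 𝓘(ℝ, E) 𝓘(ℝ, E) (extChartAt 𝓘(ℝ, E) x₀).symm (range 𝓘(ℝ, E)) z

variable [IsManifold 𝓘(ℝ, E) ∞ M]

theorem IsSmoothOn.contMDiffAt {Y : ∀ x : M, TangentSpace 𝓘(ℝ, E) x} {U : Set M}
    (hY : IsSmoothOn Y U) (hU : IsOpen U) {x : M} (hx : x ∈ U) :
    ContMDiffAt 𝓘(ℝ, E) 𝓘(ℝ, E).tangent ∞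
      (fun x => (⟨x, Y x⟩ : TangentBundle 𝓘(ℝ, E) M)) x :=
  ContMDiffOn.contMDiffAt hY (hU.mem_nhds hx)

theorem contDiffAt_chartField [CompleteSpace E] {Y : ∀ x : M, TangentSpace 𝓘(ℝ, E) x} {U : Set M}
    (hY : IsSmoothOn Y U) (hU : IsOpen U) {x : M} (hx : x ∈ U) :
    ContDiffAt ℝ ∞ (chartField x Y) (extChartAt 𝓘(ℝ, E) x x) := by
  have h := contMDiffWithinAt_mpullbackWithin_extChartAt_symm (n := ∞) (m := ∞) (s := univ)
    (hY.contMDiffAt hU hx).contMDiffWithinAt uniqueMDiffOn_univ (mem_univ x) (by simp)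
  have h2 := (contMDiff_snd_tangentBundle_modelSpace (n := ∞) E 𝓘(ℝ, E)).contMDiffAt
    |>.comp_contMDiffWithinAt _ h
  rw [preimage_univ, inter_univ] at h2
  exact (h2.contMDiffAt (extChartAt_target_mem_nhds x)).contDiffAt

theorem hasMFDerivAt_chart_symm (x₀ : M) {z : E} (hz : z ∈ (extChartAt 𝓘(ℝ, E) x₀).target) :
    HasMFDerivAt 𝓘(ℝ, E) 𝓘(ℝ, E) (extChartAt 𝓘(ℝ, E) x₀).symm z
      (chartSymmDeriv (E := E) x₀ z) := by
  have h := (mdifferentiableWithinAt_extChartAt_symm (I := 𝓘(ℝ, E)) hz).hasMFDerivWithinAt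
  have h2 := h.hasMFDerivAt (by simp)
  exact h2

theorem chartSymmDeriv_isInvertible (x₀ : M) {z : E} (hz : z ∈ (extChartAt 𝓘(ℝ, E) x₀).target) :
    (chartSymmDeriv x₀ z).IsInvertible :=
  isInvertible_mfderivWithin_extChartAt_symm hz

theorem chartSymmDeriv_chartField (x₀ : M) (Y : ∀ x : M, TangentSpace 𝓘(ℝ, E) x) {z : E}
    (hz : z ∈ (extChartAt 𝓘(ℝ, E) x₀).target) :
    chartSymmDeriv x₀ z (chartField x₀ Y z) = Y ((extChartAt 𝓘(ℝ, E) x₀).symm z) :=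
  (chartSymmDeriv_isInvertible x₀ hz).self_apply_inverse _

/-- The tangent space at `x` is identified with `E` through the chart at `x` itself, so the
derivative of that chart at its base point is the identity and no correction factor survives. -/
theorem bracket_eq_lieBracket_chartField (X Y : ∀ x : M, TangentSpace 𝓘(ℝ, E) x) (x : M) :
    bracket X Y x = lieBracket ℝ (chartField x X) (chartField x Y) (extChartAt 𝓘(ℝ, E) x x) := by
  let D : E →L[ℝ] E := mfderiv 𝓘(ℝ, E) 𝓘(ℝ, E) (extChartAt 𝓘(ℝ, E) x) x
  have hD : D = ContinuousLinearMap.id ℝ E := mfderiv_extChartAt_self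
  change D.inverse (lieBracketWithin ℝ (chartField x X) (chartField x Y)
    ((extChartAt 𝓘(ℝ, E) x).symm ⁻¹' univ ∩ range 𝓘(ℝ, E)) (extChartAt 𝓘(ℝ, E) x x)) = _
  rw [hD, ContinuousLinearMap.inverse_id]
  simp only [modelWithCornersSelf_coe, range_id, preimage_univ, inter_univ, lieBracketWithin_univ]
  rfl

theorem IsSmoothOn.bracket [CompleteSpace E] {X Y : ∀ x : M, TangentSpace 𝓘(ℝ, E) x} {U : Set M}
    (hX : IsSmoothOn X U) (hY : IsSmoothOn Y U) (hU : IsOpen U) :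
    IsSmoothOn (bracket X Y) U := by
  intro x hx
  have h1 : IsManifold 𝓘(ℝ, E) (minSmoothness ℝ 2) M := by
    rw [minSmoothness_of_isRCLikeNormedField]
    exact IsManifold.of_le (n := ∞) ENat.LEInfty.out
  have h2 : IsManifold 𝓘(ℝ, E) (((⊤ : ℕ∞) : WithTop ℕ∞) + 1) M := by
    simpa using ‹IsManifold 𝓘(ℝ, E) ∞ M›
  exact (ContMDiffAt.mlieBracket_vectorField (m := ⊤) (n := ⊤) (hX.contMDiffAt hU hx)
    (hY.contMDiffAt hU hx) (by simp)).contMDiffWithinAt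

end Chart
end DynamicPair

namespace DynamicPair
open Set Metric Topology NNReal VectorField Filter

/-! ### Local flows on the manifold and the Lie derivative -/

section Flow
variable {E : Type*} [NormedAddCommGroup E] [NormedSpace ℝ E] [CompleteSpace E]
  {M : Type*} [TopologicalSpace M] [ChartedSpace E M] [IsManifold 𝓘(ℝ, E) ∞ M]

theorem isUnit_of_norm_sub_id_le {L : E →L[ℝ] E}
    (h : ‖L - ContinuousLinearMap.id ℝ E‖ ≤ 1 / 2) : IsUnit L := by
  have h1 : ‖ContinuousLinearMap.id ℝ E - L‖ < 1 := by
    rw [norm_sub_rev]; linarith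
  have h2 := (Units.oneSub _ h1).isUnit
  have h3 : ((Units.oneSub _ h1 : (E →L[ℝ] E)ˣ) : E →L[ℝ] E) = L := by
    rw [Units.val_oneSub]
    exact sub_sub_cancel _ _
  rwa [h3] at h2

/-- The flow in the chart is conjugated back to `M`. The last clause is the Lie derivative formula:
`η` is `Y` along the trajectory pulled back by the flow. In the chart `L' = Df ∘ L` and `L = id` at
time `0`, so the derivative of `L⁻¹ Y(φ)` there is `DY(f) - Df(Y)`, the bracket. -/
theorem exists_localFlow {X : ∀ x : M, TangentSpace 𝓘(ℝ, E) x} (hX : IsSmoothOn X univ) (x₀ : M) :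
    ∃ N ∈ 𝓝 x₀, ∃ δ > 0, ∃ (ψ : ℝ → M → M) (A : ℝ → M → E →L[ℝ] E),
      (∀ y ∈ N, ψ 0 y = y ∧ IsMIntegralCurveOn (fun τ => ψ τ y) X (Ioo (-δ) δ) ∧
        ∀ τ ∈ Ioo (-δ) δ, Function.Injective (A τ y) ∧
          HasMFDerivAt 𝓘(ℝ, E) 𝓘(ℝ, E) (ψ τ) y (A τ y)) ∧
      ∀ (Y : ∀ x : M, TangentSpace 𝓘(ℝ, E) x) (U : Set M), IsOpen U → x₀ ∈ U → IsSmoothOn Y U →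
        ∃ η : ℝ → E, HasDerivAt η (bracket X Y x₀) 0 ∧
          ∀ τ ∈ Ioo (-δ) δ, A τ x₀ (η τ) = Y (ψ τ x₀) := by
  set z₀ : E := extChartAt 𝓘(ℝ, E) x₀ x₀ with hz₀
  have hf : ContDiffAt ℝ ∞ (chartField x₀ X) z₀ :=
    contDiffAt_chartField hX isOpen_univ (mem_univ x₀)
  obtain ⟨r, hr, δ, hδ, φ, L, hφ⟩ := exists_localFlow_hasFDerivAt
    (hf.of_le ENat.LEInfty.out)
    (extChartAt_target_mem_nhds (I := 𝓘(ℝ, E)) x₀)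
  let D : M → E →L[ℝ] E := fun y => mfderiv 𝓘(ℝ, E) 𝓘(ℝ, E) (extChartAt 𝓘(ℝ, E) x₀) y
  have hDself : D x₀ = ContinuousLinearMap.id ℝ E := mfderiv_extChartAt_self
  have hz₀r : z₀ ∈ ball z₀ r := mem_ball_self hr
  refine ⟨(extChartAt 𝓘(ℝ, E) x₀).source ∩ extChartAt 𝓘(ℝ, E) x₀ ⁻¹' ball z₀ r,
    inter_mem (extChartAt_source_mem_nhds x₀)
      ((continuousAt_extChartAt x₀).preimage_mem_nhds (ball_mem_nhds _ hr)), δ, hδ,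
    fun τ y => (extChartAt 𝓘(ℝ, E) x₀).symm (φ (extChartAt 𝓘(ℝ, E) x₀ y) τ),
    fun τ y => (chartSymmDeriv x₀ (φ (extChartAt 𝓘(ℝ, E) x₀ y) τ)).comp
      ((L (extChartAt 𝓘(ℝ, E) x₀ y) τ).comp (D y)), ?_, ?_⟩
  · rintro y ⟨hy1, hy2⟩
    obtain ⟨h0, hL0, h⟩ := hφ _ hy2
    refine ⟨?_, ?_, ?_⟩
    · simp only [h0]
      exact (extChartAt 𝓘(ℝ, E) x₀).left_inv hy1
    · intro τ hτ
      obtain ⟨h1, h2, -⟩ := h τ hτ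
      have h3 := (hasMFDerivAt_chart_symm x₀ h1).comp τ h2.hasFDerivAt.hasMFDerivAt
      refine HasMFDerivAt.hasMFDerivWithinAt ?_
      refine h3.congr_mfderiv ?_
      ext
      change chartSymmDeriv x₀ _ ((1 : ℝ) • chartField x₀ X _) = (1 : ℝ) • X _
      rw [one_smul, chartSymmDeriv_chartField x₀ X h1]
      exact (one_smul ℝ (X _ : E)).symm
    · intro τ hτ
      obtain ⟨h1, h2, h3, h4, h5⟩ := h τ hτ
      have hDinv : (D y).IsInvertible := isInvertible_mfderiv_extChartAt hy1
      have hD : HasMFDerivAt 𝓘(ℝ, E) 𝓘(ℝ, E) (extChartAt 𝓘(ℝ, E) x₀) y (D y) :=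
        (mdifferentiableAt_extChartAt (by simpa using hy1)).hasMFDerivAt
      refine ⟨?_, ?_⟩
      · have hLi : Function.Injective (L (extChartAt 𝓘(ℝ, E) x₀ y) τ) := by
          obtain ⟨U, hU⟩ := isUnit_of_norm_sub_id_le h4
          rw [← hU]
          exact (ContinuousLinearEquiv.unitsEquiv ℝ E U).injective
        exact (chartSymmDeriv_isInvertible x₀ h1).injective.comp (hLi.comp hDinv.injective)
      · exact (hasMFDerivAt_chart_symm x₀ h1).comp y (h5.hasMFDerivAt.comp y hD)
  · intro Y U hU hxU hY
    obtain ⟨h0, hL0, h⟩ := hφ z₀ hz₀r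
    have h00 : (0 : ℝ) ∈ Ioo (-δ) δ := ⟨by linarith, hδ⟩
    refine ⟨fun τ => Ring.inverse (L z₀ τ) (chartField x₀ Y (φ z₀ τ)), ?_, ?_⟩
    · obtain ⟨-, h2, h3, -, -⟩ := h 0 h00
      have hYd : HasFDerivAt (chartField x₀ Y) (fderiv ℝ (chartField x₀ Y) z₀) (φ z₀ 0) := by
        rw [h0]
        exact ((contDiffAt_chartField hY hU hxU).differentiableAt (by simp)).hasFDerivAt
      have hinv : HasFDerivAt Ring.inverse
          (-ContinuousLinearMap.mulLeftRight ℝ (E →L[ℝ] E) ↑(1 : (E →L[ℝ] E)ˣ)⁻¹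
            ↑(1 : (E →L[ℝ] E)ˣ)⁻¹) (L z₀ 0) := by
        rw [hL0]
        exact hasFDerivAt_ringInverse (1 : (E →L[ℝ] E)ˣ)
      have h4 := (hinv.comp_hasDerivAt (0 : ℝ) h3).clm_apply (hYd.comp_hasDerivAt (0 : ℝ) h2)
      refine h4.congr_deriv ?_
      rw [bracket_eq_lieBracket_chartField, lieBracket]
      have hone : Ring.inverse (ContinuousLinearMap.id ℝ E) = ContinuousLinearMap.id ℝ E :=
        Ring.inverse_one (E →L[ℝ] E)
      simp only [Function.comp_apply, h0, hL0, hone, ← hz₀]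
      simp
      abel
    · intro τ hτ
      obtain ⟨h1, h2, h3, h4, h5⟩ := h τ hτ
      have hLi : ∀ v, L z₀ τ (Ring.inverse (L z₀ τ) v) = v := fun v =>
        congrArg (fun B : E →L[ℝ] E => B v)
          (Ring.mul_inverse_cancel _ (isUnit_of_norm_sub_id_le h4))
      simp only [ContinuousLinearMap.comp_apply, hDself, ContinuousLinearMap.id_apply, ← hz₀, hLi]
      exact chartSymmDeriv_chartField x₀ Y h1

end Flow
end DynamicPair

namespace DynamicPair
open Set Metric Topology NNReal VectorField Filter

/-! ### Gluing and uniqueness of integral curves -/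

section Curves
variable {E : Type*} [NormedAddCommGroup E] [NormedSpace ℝ E]
  {M : Type*} [TopologicalSpace M] [ChartedSpace E M]

/-- At the junction the derivatives within the two halves agree, and derivatives within two sets
combine to a derivative within their union. The set `s` is arbitrary, so half-open intervals are
covered. -/
theorem isMIntegralCurveOn_glue {X : ∀ x : M, TangentSpace 𝓘(ℝ, E) x} {γ₁ γ₂ : ℝ → M}
    {s : Set ℝ} {a : ℝ} (h₁ : IsMIntegralCurveOn γ₁ X (s ∩ Iic a))
    (h₂ : IsMIntegralCurveOn γ₂ X (s ∩ Ici a)) (h : γ₁ a = γ₂ a) :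
    IsMIntegralCurveOn (fun t => if t ≤ a then γ₁ t else γ₂ t) X s := by
  set γ : ℝ → M := fun t => if t ≤ a then γ₁ t else γ₂ t with hγ
  have e₁ : ∀ t ≤ a, γ t = γ₁ t := fun t ht => if_pos ht
  have e₂ : ∀ t ≥ a, γ t = γ₂ t := by
    intro t ht
    rcases ht.eq_or_lt with rfl | h'
    · rw [← h]; exact if_pos le_rfl
    · exact if_neg (not_le.mpr h')
  have d₁ : ∀ t ∈ s, t ≤ a → HasMFDerivWithinAt 𝓘(ℝ, ℝ) 𝓘(ℝ, E) γ (s ∩ Iic a) t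
      ((1 : ℝ →L[ℝ] ℝ).smulRight (X (γ t))) := by
    intro t ht hta
    refine ((h₁ t ⟨ht, hta⟩).congr_of_eventuallyEq ?_ (e₁ t hta)).congr_mfderiv ?_
    · filter_upwards [self_mem_nhdsWithin] with x hx using e₁ x hx.2
    · exact congrArg (fun y => (1 : ℝ →L[ℝ] ℝ).smulRight (X y : E)) (e₁ t hta).symm
  have d₂ : ∀ t ∈ s, a ≤ t → HasMFDerivWithinAt 𝓘(ℝ, ℝ) 𝓘(ℝ, E) γ (s ∩ Ici a) t
      ((1 : ℝ →L[ℝ] ℝ).smulRight (X (γ t))) := by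
    intro t ht hta
    refine ((h₂ t ⟨ht, hta⟩).congr_of_eventuallyEq ?_ (e₂ t hta)).congr_mfderiv ?_
    · filter_upwards [self_mem_nhdsWithin] with x hx using e₂ x hx.2
    · exact congrArg (fun y => (1 : ℝ →L[ℝ] ℝ).smulRight (X y : E)) (e₂ t hta).symm
  intro t ht
  rcases lt_trichotomy t a with hta | hta | hta
  · refine (d₁ t ht hta.le).mono_of_mem_nhdsWithin ?_
    exact inter_mem self_mem_nhdsWithin (mem_nhdsWithin_of_mem_nhds (Iic_mem_nhds hta))
  · have h3 := (d₁ t ht hta.le).union (d₂ t ht hta.ge)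
    rwa [← inter_union_distrib_left, Iic_union_Ici, inter_univ] at h3
  · refine (d₂ t ht hta.le).mono_of_mem_nhdsWithin ?_
    exact inter_mem self_mem_nhdsWithin (mem_nhdsWithin_of_mem_nhds (Ici_mem_nhds hta))

variable {X : ∀ x : M, TangentSpace 𝓘(ℝ, E) x}

theorem flow_zero : flow X 0 = id := by
  funext y
  rw [flow]
  split_ifs with h
  · exact h.choose_spec.1
  · rfl

variable [IsManifold 𝓘(ℝ, E) ∞ M]

theorem IsSmoothOn.contMDiff_one (hX : IsSmoothOn X univ) :
    ContMDiff 𝓘(ℝ, E) 𝓘(ℝ, E).tangent 1 (fun x => (⟨x, X x⟩ : TangentBundle 𝓘(ℝ, E) M)) :=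
  (contMDiffOn_univ.mp hX).of_le ENat.LEInfty.out

variable [T2Space M]


/-- Integral curves on `[0, b]` are determined by their starting points. -/
theorem eqOn_Icc_of_isMIntegralCurveOn [CompleteSpace E] (hX : IsSmoothOn X univ) {γ γ' : ℝ → M} {b : ℝ}
    (hγ : IsMIntegralCurveOn γ X (Icc 0 b)) (hγ' : IsMIntegralCurveOn γ' X (Icc 0 b))
    (h : γ 0 = γ' 0) : EqOn γ γ' (Icc 0 b) := by
  rcases lt_trichotomy b 0 with hb | rfl | hb
  · simp [Icc_eq_empty (not_le.mpr hb)]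
  · simpa using h
  -- Uniqueness is available on open intervals around the common time. A common local curve is
  -- therefore attached before time `0`, and the endpoint `b` is reached by continuity.
  obtain ⟨η, hη0, hη⟩ := exists_isMIntegralCurveAt_of_contMDiffAt_boundaryless (t₀ := 0)
    (hX.contMDiff_one (γ 0))
  obtain ⟨ε, hε, hη⟩ := isMIntegralCurveAt_iff'.mp hη
  have key : ∀ γ : ℝ → M, IsMIntegralCurveOn γ X (Icc 0 b) → η 0 = γ 0 →
      IsMIntegralCurveOn (fun t => if t ≤ 0 then η t else γ t) X (Ioo (-ε) b) := by
    intro γ hγ h0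
    refine isMIntegralCurveOn_glue (hη.mono ?_) (hγ.mono ?_) h0
    · rintro t ⟨ht1, ht2⟩
      rw [mem_ball, Real.dist_eq, abs_lt]
      constructor
      · linarith [ht1.1]
      · linarith [show t ≤ 0 from ht2]
    · rintro t ⟨ht1, ht2⟩
      exact ⟨ht2, ht1.2.le⟩
  have h2 := isMIntegralCurveOn_Ioo_eqOn_of_contMDiff_boundaryless
    (t₀ := 0) ⟨by linarith, hb⟩ hX.contMDiff_one (key γ hγ hη0) (key γ' hγ' (hη0.trans h)) (by simp)
  have h3 : EqOn γ γ' (Ico 0 b) := by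
    intro t ht
    rcases ht.1.eq_or_lt with rfl | h'
    · exact h
    · have := h2 (show t ∈ Ioo (-ε) b from ⟨by linarith, ht.2⟩)
      simpa [not_le.mpr h'] using this
  exact h3.of_subset_closure hγ.continuousOn hγ'.continuousOn Ico_subset_Icc_self
    (by rw [closure_Ico hb.ne])

/-- By uniqueness, the choice made in `flow` is immaterial wherever an integral curve exists. -/
theorem flow_eq_of_isMIntegralCurveOn [CompleteSpace E] (hX : IsSmoothOn X univ) {γ : ℝ → M} {t : ℝ} (ht : 0 ≤ t)
    (hγ : IsMIntegralCurveOn γ X (Icc 0 t)) : flow X t (γ 0) = γ t := by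
  have hex : ∃ γ' : ℝ → M, γ' 0 = γ 0 ∧ IsMIntegralCurveOn γ' X (Icc 0 t) := ⟨γ, rfl, hγ⟩
  rw [flow, dif_pos hex]
  exact eqOn_Icc_of_isMIntegralCurveOn hX hex.choose_spec.2 hγ hex.choose_spec.1 ⟨ht, le_rfl⟩

/-- An integral curve on `[0, t₀]` is continued by (and near `t₀` agrees with) any integral curve
through its end point. -/
theorem exists_isMIntegralCurveOn_continuation (hX : IsSmoothOn X univ)
    {γ ζ : ℝ → M} {t₀ δ s : ℝ}
    (ht₀ : 0 ≤ t₀) (hγ : IsMIntegralCurveOn γ X (Icc 0 t₀))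
    (hζ : IsMIntegralCurveOn ζ X (Ioo (-δ) δ)) (h : γ t₀ = ζ 0) (hs : 0 ≤ s)
    (hsδ : s - t₀ ∈ Ioo (-δ) δ) :
    ∃ γ' : ℝ → M, γ' 0 = γ 0 ∧ IsMIntegralCurveOn γ' X (Icc 0 s) ∧ γ' s = ζ (s - t₀) := by
  have hδ : 0 < δ := by linarith [hsδ.1, hsδ.2]
  have hζ' : IsMIntegralCurveOn (fun t => ζ (t - t₀)) X (Ioo (t₀ - δ) (t₀ + δ)) := by
    have := hζ.comp_add (-t₀)
    refine IsMIntegralCurveOn.mono this ?_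
    rintro t ⟨h1, h2⟩
    rw [mem_ofPred_eq]
    constructor <;> linarith
  set Γ : ℝ → M := fun t => if t ≤ t₀ then γ t else ζ (t - t₀) with hΓdef
  have hΓ : IsMIntegralCurveOn Γ X (Ico 0 (t₀ + δ)) := by
    refine isMIntegralCurveOn_glue (hγ.mono ?_) (hζ'.mono ?_) (by simpa using h)
    · rintro t ⟨h1, h2⟩
      exact ⟨h1.1, h2⟩
    · rintro t ⟨h1, h2⟩
      exact ⟨by linarith [show t₀ ≤ t from h2], h1.2⟩
  refine ⟨Γ, if_pos ht₀, hΓ.mono fun t ht => ⟨ht.1, by linarith [ht.2, hsδ.2]⟩, ?_⟩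
  rcases lt_trichotomy s t₀ with hst | rfl | hst
  -- Going backwards in time, `γ` and the shifted `ζ` agree on the open interval by uniqueness. The
  -- point `s`, which may be the boundary point `0`, is included by closure.
  · have hsub : Icc s t₀ ⊆ Ico 0 (t₀ + δ) := fun t ht => ⟨hs.trans ht.1, by linarith [ht.2]⟩
    have hsub' : Icc s t₀ ⊆ Ioo (t₀ - δ) (t₀ + δ) := fun t ht =>
      ⟨by linarith [ht.1, hsδ.1], by linarith [ht.2]⟩
    have h1 : EqOn Γ (fun t => ζ (t - t₀)) (Ioo s (t₀ + δ)) :=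
      isMIntegralCurveOn_Ioo_eqOn_of_contMDiff_boundaryless (t₀ := t₀) ⟨hst, by linarith⟩
        hX.contMDiff_one (hΓ.mono fun t ht => ⟨by linarith [ht.1], ht.2⟩)
        (hζ'.mono fun t ht => ⟨by linarith [ht.1, hsδ.1], ht.2⟩) (by simp [hΓdef, h])
    have h2 : EqOn Γ (fun t => ζ (t - t₀)) (Icc s t₀) :=
      (h1.mono (Ioo_subset_Ioo_right (by linarith : t₀ ≤ t₀ + δ))).of_subset_closure
        (hΓ.continuousOn.mono hsub) (hζ'.continuousOn.mono hsub') Ioo_subset_Icc_self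
        (by rw [closure_Ioo hst.ne])
    exact h2 ⟨le_rfl, hst.le⟩
  · simp [hΓdef, h]
  · exact if_neg (not_le.mpr hst)

end Curves

/-! ### The derivative of the flow along an integral curve -/

section Transport
variable {E : Type*} [NormedAddCommGroup E] [NormedSpace ℝ E] [CompleteSpace E]
  {M : Type*} [TopologicalSpace M] [ChartedSpace E M] [T2Space M] [IsManifold 𝓘(ℝ, E) ∞ M]
  {X : ∀ x : M, TangentSpace 𝓘(ℝ, E) x}

/-- The one-parameter group law near `x`, for `s` on either side of `t₀`. Existence of the curves up
to time `s` is part of the conclusion, since `flow` has a junk value otherwise and the argument is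
iterated. -/
theorem flow_eventuallyEq_comp (hX : IsSmoothOn X univ) {x : M} {N : Set M} {δ : ℝ}
    {ψ : ℝ → M → M}
    (hψ : ∀ y ∈ N, ψ 0 y = y ∧ IsMIntegralCurveOn (fun τ => ψ τ y) X (Ioo (-δ) δ))
    {t₀ s : ℝ} (ht₀ : 0 ≤ t₀) (hs : 0 ≤ s) (hsδ : s - t₀ ∈ Ioo (-δ) δ)
    (hex : ∀ᶠ y in 𝓝 x, ∃ γ : ℝ → M, γ 0 = y ∧ IsMIntegralCurveOn γ X (Icc 0 t₀))
    (hN : ∀ᶠ y in 𝓝 x, flow X t₀ y ∈ N) :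
    (∀ᶠ y in 𝓝 x, ∃ γ : ℝ → M, γ 0 = y ∧ IsMIntegralCurveOn γ X (Icc 0 s)) ∧
      flow X s =ᶠ[𝓝 x] ψ (s - t₀) ∘ flow X t₀ := by
  have key : ∀ᶠ y in 𝓝 x, ∃ γ : ℝ → M, γ 0 = y ∧ IsMIntegralCurveOn γ X (Icc 0 s) ∧
      γ s = ψ (s - t₀) (flow X t₀ y) := by
    filter_upwards [hex, hN] with y ⟨γ, hγ0, hγ⟩ hy
    obtain ⟨h0, hζ⟩ := hψ _ hy
    have h1 := flow_eq_of_isMIntegralCurveOn hX ht₀ hγ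
    rw [hγ0] at h1
    obtain ⟨γ', h2, h3, h4⟩ := exists_isMIntegralCurveOn_continuation hX ht₀ hγ hζ
      (by rw [h0, h1]) hs hsδ
    exact ⟨γ', h2.trans hγ0, h3, h4⟩
  refine ⟨key.mono fun y ⟨γ, h1, h2, _⟩ => ⟨γ, h1, h2⟩, key.mono ?_⟩
  rintro y ⟨γ, rfl, h2, h3⟩
  rw [flow_eq_of_isMIntegralCurveOn hX hs h2, h3]
  rfl

/-- Along an integral curve the flow is defined and differentiable near the starting point, and
its derivative is injective. -/
theorem flow_hasMFDerivAt (hX : IsSmoothOn X univ) {c : ℝ → M} {b : ℝ}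
    (hc : IsMIntegralCurveOn c X (Icc 0 b)) {t : ℝ} (ht : t ∈ Icc 0 b) :
    (∀ᶠ y in 𝓝 (c 0), ∃ γ : ℝ → M, γ 0 = y ∧ IsMIntegralCurveOn γ X (Icc 0 t)) ∧
      ∃ A : E →L[ℝ] E, Function.Injective A ∧
        HasMFDerivAt 𝓘(ℝ, E) 𝓘(ℝ, E) (flow X t) (c 0) A := by
  set S : ℝ → Prop := fun t =>
    (∀ᶠ y in 𝓝 (c 0), ∃ γ : ℝ → M, γ 0 = y ∧ IsMIntegralCurveOn γ X (Icc 0 t)) ∧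
      ∃ A : E →L[ℝ] E, Function.Injective A ∧
        HasMFDerivAt 𝓘(ℝ, E) 𝓘(ℝ, E) (flow X t) (c 0) A with hS
  have hflow : ∀ t ∈ Icc 0 b, flow X t (c 0) = c t := fun t ht =>
    flow_eq_of_isMIntegralCurveOn hX ht.1 (hc.mono (Icc_subset_Icc_right ht.2))
  have h0 : S 0 := by
    refine ⟨Eventually.of_forall fun y => ?_, ContinuousLinearMap.id ℝ E,
      Function.injective_id, ?_⟩
    · obtain ⟨η, hη0, hη⟩ := exists_isMIntegralCurveAt_of_contMDiffAt_boundaryless (t₀ := 0)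
        (hX.contMDiff_one y)
      obtain ⟨s, hs, hη⟩ := isMIntegralCurveAt_iff.mp hη
      refine ⟨η, hη0, hη.mono ?_⟩
      rw [Icc_self, singleton_subset_iff]
      exact mem_of_mem_nhds hs
    · rw [flow_zero]
      exact hasMFDerivAt_id _
  have step : ∀ t₀ ∈ Icc 0 b, ∀ N ∈ 𝓝 (c t₀), ∀ (δ : ℝ) (ψ : ℝ → M → M) (A : ℝ → M → E →L[ℝ] E),
      (∀ y ∈ N, ψ 0 y = y ∧ IsMIntegralCurveOn (fun τ => ψ τ y) X (Ioo (-δ) δ) ∧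
        ∀ τ ∈ Ioo (-δ) δ, Function.Injective (A τ y) ∧
          HasMFDerivAt 𝓘(ℝ, E) 𝓘(ℝ, E) (ψ τ) y (A τ y)) →
      ∀ s ∈ Icc 0 b, s - t₀ ∈ Ioo (-δ) δ → S t₀ → S s := by
    intro t₀ ht₀ N hN δ ψ A hψ s hs hsδ ⟨h1, B, hB, hBd⟩
    have hcont : ContinuousAt (flow X t₀) (c 0) := hBd.continuousAt
    have hN' : ∀ᶠ y in 𝓝 (c 0), flow X t₀ y ∈ N := by
      refine hcont ?_
      rw [hflow t₀ ht₀]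
      exact hN
    obtain ⟨h2, h3⟩ := flow_eventuallyEq_comp hX (fun y hy => ⟨(hψ y hy).1, (hψ y hy).2.1⟩)
      ht₀.1 hs.1 hsδ h1 hN'
    obtain ⟨h4, h5⟩ := (hψ _ hN'.self_of_nhds).2.2 _ hsδ
    exact ⟨h2, (A (s - t₀) (flow X t₀ (c 0))).comp B, h4.comp hB,
      (h5.comp (c 0) hBd).congr_of_eventuallyEq h3⟩
  have hb : (0 : ℝ) ∈ Icc 0 b := ⟨le_rfl, ht.1.trans ht.2⟩
  -- Connectedness of `[0, b]` carries `S` from `0` to `t`. Implications in both directions between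
  -- nearby times are required; one local flow provides both, as its neighbourhood and time span
  -- serve all nearby points of `c`.
  refine isPreconnected_Icc.induction₂' (fun t s => S t → S s) (fun t₀ ht₀ => ?_)
    (fun _ _ _ _ _ _ h1 h2 h => h2 (h1 h)) hb ht h0
  obtain ⟨N, hN, δ, hδ, ψ, A, hψ, -⟩ := exists_localFlow hX (c t₀)
  obtain ⟨N', hN'N, hN'o, hN'⟩ := mem_nhds_iff.mp hN
  have e1 : ∀ᶠ s in 𝓝[Icc 0 b] t₀, c s ∈ N' :=
    hc.continuousWithinAt ht₀ (hN'o.mem_nhds hN')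
  have e2 : ∀ᶠ s in 𝓝[Icc 0 b] t₀, s ∈ Ioo (t₀ - δ) (t₀ + δ) :=
    mem_nhdsWithin_of_mem_nhds (Ioo_mem_nhds (by linarith) (by linarith))
  filter_upwards [e1, e2, self_mem_nhdsWithin] with s hs1 hs2 hs3
  refine ⟨step t₀ ht₀ N hN δ ψ A hψ s hs3 ⟨by linarith [hs2.1], by linarith [hs2.2]⟩,
    step s hs3 N (mem_of_superset (hN'o.mem_nhds hs1) hN'N) δ ψ A hψ t₀ ht₀
      ⟨by linarith [hs2.2], by linarith [hs2.1]⟩⟩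

/-- The derivatives `P t` of the flow along an integral curve `c`, and the Lie derivative: pulled
back to `c 0` by the flow, the derivative of a vector field along `c` is its bracket with `X`. -/
theorem exists_transport [FiniteDimensional ℝ E] (hX : IsSmoothOn X univ) {c : ℝ → M} {b : ℝ}
    (hc : IsMIntegralCurveOn c X (Icc 0 b)) :
    ∃ P R : ℝ → E →L[ℝ] E, (∀ v, P 0 v = v) ∧ ∀ t ∈ Icc 0 b, flow X t (c 0) = c t ∧
      (∀ v, P t v = mfderiv 𝓘(ℝ, E) 𝓘(ℝ, E) (flow X t) (c 0) v) ∧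
      (∀ v, R t (P t v) = v) ∧ (∀ v, P t (R t v) = v) ∧
      ∀ (Y : ∀ x : M, TangentSpace 𝓘(ℝ, E) x) (U : Set M), IsOpen U → c t ∈ U → IsSmoothOn Y U →
        HasDerivWithinAt (fun s => R s (Y (c s))) (R t (bracket X Y (c t))) (Icc 0 b) t := by
  have hflow : ∀ t ∈ Icc 0 b, flow X t (c 0) = c t := fun t ht =>
    flow_eq_of_isMIntegralCurveOn hX ht.1 (hc.mono (Icc_subset_Icc_right ht.2))
  have hmain := fun t (ht : t ∈ Icc 0 b) => flow_hasMFDerivAt hX hc ht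
  let P : ℝ → E →L[ℝ] E := fun t => mfderiv 𝓘(ℝ, E) 𝓘(ℝ, E) (flow X t) (c 0)
  have hP : ∀ t ∈ Icc 0 b, HasMFDerivAt 𝓘(ℝ, E) 𝓘(ℝ, E) (flow X t) (c 0) (P t) ∧
      Function.Injective (P t) := by
    intro t ht
    obtain ⟨-, A, hA, hAd⟩ := hmain t ht
    have : P t = A := hAd.mfderiv
    rw [this]
    exact ⟨hAd, hA⟩
  have hinv : ∀ t, ∃ R : E →L[ℝ] E, t ∈ Icc 0 b → (∀ v, R (P t v) = v) ∧ ∀ v, P t (R v) = v := by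
    intro t
    by_cases ht : t ∈ Icc 0 b
    · let e := (LinearEquiv.ofInjectiveEndo (P t).toLinearMap (hP t ht).2).toContinuousLinearEquiv
      refine ⟨e.symm, fun _ => ⟨fun v => e.symm_apply_apply v, fun v => e.apply_symm_apply v⟩⟩
    · exact ⟨0, fun h => absurd h ht⟩
  choose R hR using hinv
  refine ⟨P, R, ?_, fun t ht => ⟨hflow t ht, fun v => rfl, (hR t ht).1, (hR t ht).2, ?_⟩⟩
  · intro v
    have h : HasMFDerivAt 𝓘(ℝ, E) 𝓘(ℝ, E) (flow X 0) (c 0) (ContinuousLinearMap.id ℝ E) := by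
      rw [flow_zero]
      exact hasMFDerivAt_id _
    have : P 0 = ContinuousLinearMap.id ℝ E := h.mfderiv
    rw [this]; rfl
  intro Y U hU hct hY
  obtain ⟨N, hN, δ, hδ, ψ, A, hψ, hlie⟩ := exists_localFlow hX (c t)
  obtain ⟨η, hη, hηA⟩ := hlie Y U hU hct hY
  have hN' : ∀ᶠ y in 𝓝 (c 0), flow X t y ∈ N := by
    have hcont : ContinuousAt (flow X t) (c 0) := (hP t ht).1.continuousAt
    refine hcont ?_
    rw [hflow t ht]
    exact hN
  -- The chain rule gives `P s = A (s - t) ∘ P t`. The pulled back field is thus `R t` applied to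
  -- the local curve `η`, whose derivative at `0` is the bracket.
  have key : ∀ s ∈ Icc 0 b, s - t ∈ Ioo (-δ) δ → R s (Y (c s)) = R t (η (s - t)) := by
    intro s hs hsδ
    obtain ⟨-, h1⟩ := flow_eventuallyEq_comp hX (fun y hy => ⟨(hψ y hy).1, (hψ y hy).2.1⟩)
      ht.1 hs.1 hsδ (hmain t ht).1 hN'
    have h2 := ((hψ (c t) (mem_of_mem_nhds hN)).2.2 _ hsδ).2
    rw [← hflow t ht] at h2
    have h3 := (h2.comp (c 0) (hP t ht).1).congr_of_eventuallyEq h1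
    have h4 : P s = (A (s - t) (flow X t (c 0))).comp (P t) := h3.mfderiv
    have h5 := h1.self_of_nhds
    rw [Function.comp_apply, hflow s hs, hflow t ht] at h5
    have h6 : A (s - t) (c t) (η (s - t)) = Y (c s) := by
      rw [hηA _ hsδ, h5]
    rw [← (hR s hs).1 (R t (η (s - t))), h4, ContinuousLinearMap.comp_apply, (hR t ht).2,
      hflow t ht, h6]
  have h0 : R t (Y (c t)) = R t (η (t - t)) := key t ht (by simp [hδ])
  have hη' : HasDerivAt (fun s => η (s - t)) (bracket X Y (c t)) t := by
    have : HasDerivAt η (bracket X Y (c t)) (t - t) := by rwa [sub_self]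
    exact HasDerivAt.comp_sub_const t t this
  have h1 : HasDerivAt (fun s => R t (η (s - t))) (R t (bracket X Y (c t))) t :=
    (R t).hasFDerivAt.comp_hasDerivAt t hη'
  refine h1.hasDerivWithinAt.congr_of_eventuallyEq ?_ h0
  have e2 : ∀ᶠ s in 𝓝[Icc 0 b] t, s ∈ Ioo (t - δ) (t + δ) :=
    mem_nhdsWithin_of_mem_nhds (Ioo_mem_nhds (by linarith) (by linarith))
  filter_upwards [e2, self_mem_nhdsWithin] with s hs1 hs2
  exact key s hs2 ⟨by linarith [hs1.1], by linarith [hs1.2]⟩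

end Transport
end DynamicPair

namespace DynamicPair
open Set Metric Topology NNReal Filter Matrix

/-! ### The trace inequality and the Riccati comparison -/

section Riccati

/-- Write `g⁻¹ = Bᵀ B` and `S = g N`, a symmetric matrix. Then `N = Bᵀ B S`, and by cyclicity `tr
N²` is the trace of the square of the symmetric matrix `B S Bᵀ`. -/
theorem trace_mul_self_nonneg_of_posDef {n : Type*} [Fintype n] [DecidableEq n]
    {g N : Matrix n n ℝ} (hg : g.PosDef) (hN : (g * N)ᵀ = g * N) : 0 ≤ (N * N).trace := by
  obtain ⟨B, hB⟩ : ∃ B : Matrix n n ℝ, g⁻¹ = Bᵀ * B := by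
    open scoped MatrixOrder Matrix.Norms.L2Operator in
    obtain ⟨B, hB⟩ := CStarAlgebra.nonneg_iff_eq_star_mul_self.mp hg.inv.posSemidef.nonneg
    exact ⟨B, by rw [hB, star_eq_conjTranspose, conjTranspose_eq_transpose_of_trivial]⟩
  have hgu : g⁻¹ * g = 1 := nonsing_inv_mul g ((isUnit_iff_isUnit_det g).mp hg.isUnit)
  set S := g * N with hS
  have h1 : N = Bᵀ * B * S := by rw [← hB, hS, ← mul_assoc, hgu, one_mul]
  have h2 : (N * N).trace = ((B * S * Bᵀ)ᵀ * (B * S * Bᵀ)).trace := by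
    have h3 : (B * S * Bᵀ)ᵀ = B * S * Bᵀ := by
      simp only [transpose_mul, transpose_transpose, hN, mul_assoc]
    rw [h3, h1, show Bᵀ * B * S * (Bᵀ * B * S) = Bᵀ * (B * S * Bᵀ * B * S) by
      simp only [mul_assoc], trace_mul_comm]
    simp only [mul_assoc]
  rw [h2]
  have := (posSemidef_conjTranspose_mul_self (B * S * Bᵀ)).trace_nonneg
  rwa [conjTranspose_eq_transpose_of_trivial] at this

/-- The trace inequality for operators which are symmetric for a definite form. -/
theorem sq_trace_le_of_posDef {m : ℕ} (hm : 0 < m) {g N : Matrix (Fin m) (Fin m) ℝ}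
    (hg : g.PosDef) (hN : (g * N)ᵀ = g * N) :
    N.trace ^ 2 / m ≤ (N * N).trace := by
  have hm' : (0 : ℝ) < m := by exact_mod_cast hm
  set τ := N.trace / m with hτ
  have hτm : N.trace = τ * m := by rw [hτ]; field_simp
  have hgs : gᵀ = g := by
    have := hg.isHermitian
    rwa [IsHermitian, conjTranspose_eq_transpose_of_trivial] at this
  -- Applied to the trace-free part of `N`, this is the Cauchy-Schwarz inequality for the
  -- eigenvalues.
  have h := trace_mul_self_nonneg_of_posDef (g := g) (N := N - τ • 1) hg (by
    rw [mul_sub, transpose_sub, hN, mul_smul_comm, transpose_smul, mul_one, hgs])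
  have e : (N - τ • 1) * (N - τ • 1) = N * N - (2 * τ) • N + (τ * τ) • 1 := by
    simp only [sub_mul, mul_sub, smul_mul_assoc, mul_smul_comm, one_mul, mul_one, smul_sub]
    module
  rw [e, trace_add, trace_sub, trace_smul, trace_smul, trace_one, Fintype.card_fin, hτm] at h
  simp only [smul_eq_mul] at h
  rw [hτm, div_le_iff₀ hm']
  nlinarith

/-- A solution of the Riccati inequality `h' ≥ 2 κ + h² / (2 m)` cannot exist on `(0, π m / √κ]`. -/
theorem riccati_blowup {m : ℕ} (hm : 0 < m) {κ : ℝ} (hκ : 0 < κ) {h h' : ℝ → ℝ}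
    (hd : ∀ t ∈ Ioc 0 (Real.pi * m / √κ), HasDerivWithinAt h (h' t) (Icc 0 (Real.pi * m / √κ)) t)
    (hh : ∀ t ∈ Ioc 0 (Real.pi * m / √κ), 2 * κ + h t ^ 2 / (2 * m) ≤ h' t) : False := by
  have hm' : (1 : ℝ) ≤ m := by exact_mod_cast hm
  have hm0 : (0 : ℝ) < m := by linarith
  have hsκ : 0 < √κ := Real.sqrt_pos.mpr hκ
  set b := Real.pi * m / √κ with hb
  have hb0 : 0 < b := by positivity
  set k := √κ / √m with hk
  have hsm : 0 < √(m : ℝ) := Real.sqrt_pos.mpr hm0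
  have hk0 : 0 < k := by positivity
  have hk2 : k ^ 2 = κ / m := by
    rw [hk, div_pow, Real.sq_sqrt hκ.le, Real.sq_sqrt hm0.le]
  have hkb : Real.pi ≤ k * b := by
    have h1 : k * b = Real.pi * √m := by
      rw [hk, hb]
      field_simp
      rw [Real.sq_sqrt hm0.le]
    rw [h1]
    have : 1 ≤ √(m : ℝ) := Real.one_le_sqrt.mpr hm'
    nlinarith [Real.pi_pos]
  -- With `k² = κ / m` the Riccati inequality becomes exactly `θ' ≥ k`.
  set θ : ℝ → ℝ := fun t => Real.arctan (h t / (2 * m * k)) with hθ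
  have hθd : ∀ t ∈ Ioc 0 b, HasDerivWithinAt (fun t => θ t - k * t)
      (1 / (1 + (h t / (2 * m * k)) ^ 2) * (h' t / (2 * m * k)) - k) (Icc 0 b) t := by
    intro t ht
    exact ((hd t ht).div_const _).arctan.sub
      (by simpa using (hasDerivWithinAt_id t _).const_mul k)
  have hnn : ∀ t ∈ Ioc 0 b,
      0 ≤ 1 / (1 + (h t / (2 * m * k)) ^ 2) * (h' t / (2 * m * k)) - k := by
    intro t ht
    have h1 := hh t ht
    have h2 : 0 < 1 + (h t / (2 * m * k)) ^ 2 := by positivity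
    rw [sub_nonneg, one_div_mul_eq_div, le_div_iff₀ h2, le_div_iff₀ (by positivity)]
    refine le_trans (le_of_eq ?_) h1
    have h3 : κ = k ^ 2 * m := by rw [hk2]; field_simp
    rw [h3]
    field_simp
  have hmono : ∀ ε ∈ Ioc 0 b, θ ε - k * ε ≤ θ b - k * b := by
    intro ε hε
    have hsub : Icc ε b ⊆ Ioc 0 b := fun t ht => ⟨hε.1.trans_le ht.1, ht.2⟩
    have hsub' : Icc ε b ⊆ Icc 0 b := Icc_subset_Icc_left hε.1.le
    have := monotoneOn_of_hasDerivWithinAt_nonneg (convex_Icc ε b)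
      (f := fun t => θ t - k * t)
      (fun t ht => ((hθd t (hsub ht)).mono hsub').continuousWithinAt)
      (fun t ht => (hθd t (hsub (interior_subset ht))).mono (interior_subset.trans hsub'))
      (fun t ht => hnn t (hsub (interior_subset ht)))
    exact this ⟨le_rfl, hε.2⟩ ⟨hε.2, le_rfl⟩ hε.2
  have hup : θ b < Real.pi / 2 := Real.arctan_lt_pi_div_two _
  -- Nothing is known at time `0`, so the comparison starts at `ε`. The loss `k ε` is absorbed by
  -- the gap between `θ b` and `π / 2`.
  obtain ⟨ε, hε0, hε1, hε2⟩ : ∃ ε > 0, ε ≤ b ∧ k * ε < Real.pi / 2 - θ b := by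
    refine ⟨min b ((Real.pi / 2 - θ b) / (2 * k)), lt_min hb0 (by
      have : 0 < Real.pi / 2 - θ b := by linarith
      positivity), min_le_left _ _, ?_⟩
    have h1 : min b ((Real.pi / 2 - θ b) / (2 * k)) ≤ (Real.pi / 2 - θ b) / (2 * k) :=
      min_le_right _ _
    calc k * _ ≤ k * ((Real.pi / 2 - θ b) / (2 * k)) := by gcongr
      _ = (Real.pi / 2 - θ b) / 2 := by field_simp
      _ < _ := by linarith
  have h1 := hmono ε ⟨hε0, hε1⟩
  have h2 : -(Real.pi / 2) < θ ε := Real.neg_pi_div_two_lt_arctan _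
  linarith

end Riccati

/-! ### Derivatives of matrix-valued curves -/

section MatrixCalculus

open scoped Matrix.Norms.Operator

variable {m : ℕ} {J : Set ℝ} {t : ℝ}

theorem hasDerivWithinAt_matrix {A : ℝ → Matrix (Fin m) (Fin m) ℝ} {A' : Matrix (Fin m) (Fin m) ℝ}
    (h : ∀ i j, HasDerivWithinAt (fun s => A s i j) (A' i j) J t) : HasDerivWithinAt A A' J t := by
  have h1 : HasDerivWithinAt (fun s => ∑ i, ∑ j, A s i j • Matrix.single i j (1 : ℝ))
      (∑ i, ∑ j, A' i j • Matrix.single i j (1 : ℝ)) J t :=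
    HasDerivWithinAt.fun_sum fun i _ => HasDerivWithinAt.fun_sum fun j _ =>
      (h i j).smul_const _
  simpa [smul_single, ← matrix_eq_sum_single] using h1

theorem hasDerivWithinAt_trace {A : ℝ → Matrix (Fin m) (Fin m) ℝ} {A' : Matrix (Fin m) (Fin m) ℝ}
    (h : HasDerivWithinAt A A' J t) : HasDerivWithinAt (fun s => (A s).trace) A'.trace J t :=
  (LinearMap.toContinuousLinearMap
    (Matrix.traceLinearMap (Fin m) ℝ ℝ)).hasFDerivAt.comp_hasDerivWithinAt t h

theorem hasDerivWithinAt_matrix_inv {A : ℝ → Matrix (Fin m) (Fin m) ℝ}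
    {A' : Matrix (Fin m) (Fin m) ℝ} (h : HasDerivWithinAt A A' J t) (hA : IsUnit (A t)) :
    HasDerivWithinAt (fun s => (A s)⁻¹) (-((A t)⁻¹ * A' * (A t)⁻¹)) J t := by
  obtain ⟨u, hu⟩ := hA
  have h1 : HasFDerivAt Ring.inverse
      (-ContinuousLinearMap.mulLeftRight ℝ (Matrix (Fin m) (Fin m) ℝ) ↑u⁻¹ ↑u⁻¹) (A t) := by
    rw [← hu]; exact hasFDerivAt_ringInverse u
  have h2 := h1.comp_hasDerivWithinAt t h
  have h3 : (fun s => (A s)⁻¹) = Ring.inverse ∘ A := by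
    funext s; exact nonsing_inv_eq_ringInverse (A s)
  rw [h3]
  refine h2.congr_deriv ?_
  rw [← hu, nonsing_inv_eq_ringInverse, Ring.inverse_unit]
  rfl

/-- The derivative of `tr H₁ - 2 tr (A⁻¹ A')` for a solution `A` of `A'' = A H₀ + A' H₁`. -/
theorem hasDerivWithinAt_trace_sub {A A₁ H₁ : ℝ → Matrix (Fin m) (Fin m) ℝ}
    {H₀ H₁' : Matrix (Fin m) (Fin m) ℝ} (hA : HasDerivWithinAt A (A₁ t) J t)
    (hA₁ : HasDerivWithinAt A₁ (A t * H₀ + A₁ t * H₁ t) J t) (hH₁ : HasDerivWithinAt H₁ H₁' J t)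
    (hu : IsUnit (A t)) :
    HasDerivWithinAt (fun s => (H₁ s).trace - 2 * ((A s)⁻¹ * A₁ s).trace)
      (2 * (-H₀ + (1 / 2 : ℝ) • H₁' - (1 / 4 : ℝ) • (H₁ t * H₁ t)).trace +
        1 / 2 * ((H₁ t - (2 : ℝ) • ((A t)⁻¹ * A₁ t)) * (H₁ t - (2 : ℝ) • ((A t)⁻¹ * A₁ t))).trace)
      J t := by
  have h1 := (hasDerivWithinAt_trace hH₁).sub
    ((hasDerivWithinAt_trace ((hasDerivWithinAt_matrix_inv hA hu).mul hA₁)).const_mul 2)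
  refine h1.congr_deriv ?_
  have hinv : (A t)⁻¹ * A t = 1 := nonsing_inv_mul _ ((isUnit_iff_isUnit_det _).mp hu)
  set C := (A t)⁻¹ * A₁ t with hC
  have e1 : (A t)⁻¹ * (A t * H₀ + A₁ t * H₁ t) = H₀ + C * H₁ t := by
    rw [mul_add, ← mul_assoc, hinv, one_mul, ← mul_assoc]
  have e2 : -(C * (A t)⁻¹) * A₁ t = -(C * C) := by
    rw [neg_mul, mul_assoc]
  -- Cyclicity identifies the two cross terms in the expansion of `(H₁ - 2 C)²`, which completes the
  -- square.
  have e3 : (H₁ t * C).trace = (C * H₁ t).trace := trace_mul_comm _ _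
  simp only [e1, e2, mul_sub, sub_mul, mul_smul_comm, smul_mul_assoc, trace_add, trace_sub,
    trace_neg, trace_smul, smul_eq_mul, e3]
  ring

end MatrixCalculus
end DynamicPair

namespace DynamicPair
open Set Metric Topology NNReal Filter Matrix

/-! ### Curves of isotropic subspaces in a fixed space with an alternating form -/

section Frames

open scoped Matrix.Norms.Operator

variable {E : Type*} [NormedAddCommGroup E] [NormedSpace ℝ E] {m : ℕ}

/-- The matrix `β (u i) (w j)` of two families of vectors. -/
def gram (β : E →ₗ[ℝ] E →ₗ[ℝ] ℝ) (u w : Fin m → E) : Matrix (Fin m) (Fin m) ℝ :=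
  Matrix.of fun i j => β (u i) (w j)

/-- `e` is, near `t`, a frame of the curve `Λ` of `β`-isotropic subspaces, with first and second
derivatives `e₁`, `e₂ = e H₀ + e₁ H₁`, and with definite metric `β(e₁, e)`. -/
structure IsFrameNear (β : E →ₗ[ℝ] E →ₗ[ℝ] ℝ) (Λ : ℝ → Submodule ℝ E) (J : Set ℝ) (t : ℝ)
    (e e₁ e₂ : ℝ → Fin m → E) (H₀ H₁ : ℝ → Matrix (Fin m) (Fin m) ℝ) : Prop where
  deriv : ∀ᶠ s in 𝓝[J] t, ∀ i, HasDerivWithinAt (fun r => e r i) (e₁ s i) J s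
  deriv₁ : ∀ᶠ s in 𝓝[J] t, ∀ i, HasDerivWithinAt (fun r => e₁ r i) (e₂ s i) J s
  eq : ∀ᶠ s in 𝓝[J] t, ∀ j, e₂ s j = ∑ i, H₀ s i j • e s i + ∑ i, H₁ s i j • e₁ s i
  span : ∀ᶠ s in 𝓝[J] t, Submodule.span ℝ (range (e s)) = Λ s
  isotropic : ∀ᶠ s in 𝓝[J] t, ∀ i j, β (e s i) (e s j) = 0
  definite : ∀ᶠ s in 𝓝[J] t, (∀ x, x ≠ 0 → 0 < x ⬝ᵥ gram β (e₁ s) (e s) *ᵥ x) ∨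
    ∀ x, x ≠ 0 → x ⬝ᵥ gram β (e₁ s) (e s) *ᵥ x < 0

variable {β : E →ₗ[ℝ] E →ₗ[ℝ] ℝ} {Λ : ℝ → Submodule ℝ E} {J : Set ℝ} {t : ℝ}
  {e e₁ e₂ e' e₁' e₂' : ℝ → Fin m → E} {H₀ H₁ H₀' H₁' : ℝ → Matrix (Fin m) (Fin m) ℝ}

theorem IsFrameNear.eventually (h : IsFrameNear β Λ J t e e₁ e₂ H₀ H₁) :
    ∀ᶠ s in 𝓝[J] t, IsFrameNear β Λ J s e e₁ e₂ H₀ H₁ := by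
  filter_upwards [eventually_eventually_nhdsWithin.mpr h.deriv,
    eventually_eventually_nhdsWithin.mpr h.deriv₁, eventually_eventually_nhdsWithin.mpr h.eq,
    eventually_eventually_nhdsWithin.mpr h.span,
    eventually_eventually_nhdsWithin.mpr h.isotropic,
    eventually_eventually_nhdsWithin.mpr h.definite] with s h1 h2 h3 h4 h5 h6
  exact ⟨h1, h2, h3, h4, h5, h6⟩

theorem apply_swap_of_alternating (hβ : ∀ x, β x x = 0) (x y : E) : β x y = -β y x := by
  have h := hβ (x + y)
  simp only [map_add, LinearMap.add_apply, hβ, zero_add, add_zero] at h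
  linarith

theorem isUnit_of_definite {g : Matrix (Fin m) (Fin m) ℝ}
    (h : (∀ x, x ≠ 0 → 0 < x ⬝ᵥ g *ᵥ x) ∨ ∀ x, x ≠ 0 → x ⬝ᵥ g *ᵥ x < 0) : IsUnit g := by
  rw [← mulVec_injective_iff_isUnit]
  refine (injective_iff_map_eq_zero g.mulVecLin).mpr fun x hx => ?_
  by_contra hx0
  have hx' : g *ᵥ x = 0 := hx
  rcases h with h | h
  · have := h x hx0
    simp [hx'] at this
  · have := h x hx0
    simp [hx'] at this

/-- The conclusion does not involve `g`, so the negative definite case follows with `-g`. -/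
theorem sq_trace_le_of_definite (hm : 0 < m) {g N : Matrix (Fin m) (Fin m) ℝ}
    (h : (∀ x, x ≠ 0 → 0 < x ⬝ᵥ g *ᵥ x) ∨ ∀ x, x ≠ 0 → x ⬝ᵥ g *ᵥ x < 0) (hg : gᵀ = g)
    (hN : (g * N)ᵀ = g * N) : N.trace ^ 2 / m ≤ (N * N).trace := by
  rcases h with h | h
  · refine sq_trace_le_of_posDef hm (PosDef.of_dotProduct_mulVec_pos ?_ fun x hx => ?_) hN
    · rwa [IsHermitian, conjTranspose_eq_transpose_of_trivial]
    · simpa using h x hx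
  · refine sq_trace_le_of_posDef (g := -g) hm
      (PosDef.of_dotProduct_mulVec_pos ?_ fun x hx => ?_) ?_
    · rw [IsHermitian, conjTranspose_eq_transpose_of_trivial, transpose_neg, hg]
    · simpa [neg_mulVec] using h x hx
    · rw [neg_mul, transpose_neg, hN]

/-- The skew part of `g C`, `C = A⁻¹ A'`, for an isotropic family `v` in the span of `e`, `e₁`. -/
theorem gram_mul_sub_of_isotropic (hβ : ∀ x, β x x = 0) {v u u₁ : Fin m → E}
    (hv : ∀ k l, β (v k) (v l) = 0) (hu : ∀ i j, β (u i) (u j) = 0)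
    (hg : (gram β u₁ u)ᵀ = gram β u₁ u) (hA : IsUnit (gram β v u))
    {a b : Matrix (Fin m) (Fin m) ℝ}
    (hab : ∀ k, v k = ∑ i, a i k • u i + ∑ i, b i k • u₁ i) :
    gram β u₁ u * ((gram β v u)⁻¹ * gram β v u₁) -
      (gram β u₁ u * ((gram β v u)⁻¹ * gram β v u₁))ᵀ = gram β u₁ u₁ := by
  set g := gram β u₁ u with hgdef
  set A := gram β v u with hAdef
  set A₁ := gram β v u₁ with hA₁def
  set S := gram β u₁ u₁ with hSdef
  -- Isotropy of `u` removes `a` from `A`, and isotropy of `v` gives `A a + A₁ b = 0`, that is `a =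
  -- -C b`.
  have e1 : A = bᵀ * g := by
    ext k i
    rw [hAdef, gram, of_apply, hab k]
    simp [gram, hgdef, Matrix.mul_apply, hu]
  have e2 : A₁ = -(aᵀ * g) + bᵀ * S := by
    ext k i
    rw [← hg, hA₁def, gram, of_apply, hab k]
    simp only [map_add, map_sum, map_smul, LinearMap.add_apply, LinearMap.sum_apply,
      LinearMap.smul_apply, smul_eq_mul, Matrix.add_apply, Matrix.neg_apply, Matrix.mul_apply, transpose_apply,
      hgdef, hSdef, gram, of_apply]
    rw [← Finset.sum_neg_distrib]
    congr 1
    refine Finset.sum_congr rfl fun j _ => ?_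
    rw [apply_swap_of_alternating hβ]
    ring
  have e3 : A * a + A₁ * b = 0 := by
    ext k l
    have := hv k l
    rw [hab l] at this
    simp only [map_add, map_sum, map_smul, smul_eq_mul] at this
    simp only [Matrix.add_apply, Matrix.mul_apply, hAdef, hA₁def, gram, of_apply, Matrix.zero_apply]
    rw [← this]
    congr 1 <;> exact Finset.sum_congr rfl fun j _ => mul_comm _ _
  have hAi : A⁻¹ * A = 1 := nonsing_inv_mul _ ((isUnit_iff_isUnit_det _).mp hA)
  have hAi' : A * A⁻¹ = 1 := mul_nonsing_inv _ ((isUnit_iff_isUnit_det _).mp hA)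
  set C := A⁻¹ * A₁ with hC
  have e4 : a = -(C * b) := by
    have : A⁻¹ * (A * a + A₁ * b) = 0 := by rw [e3, mul_zero]
    rw [mul_add, ← mul_assoc, hAi, one_mul, ← mul_assoc] at this
    exact eq_neg_of_add_eq_zero_left this
  have e5 : A₁ = A * C := by rw [hC, ← mul_assoc, hAi', one_mul]
  -- Two expressions for `A₁` are compared: `A C = bᵀ g C`, and the expansion of `v` with `a`
  -- eliminated. The factor `bᵀ` cancels because `A = bᵀ g` is invertible.
  have e6 : bᵀ * (g * C - (g * C)ᵀ - S) = 0 := by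
    have h1 : A₁ = bᵀ * (g * C) := by rw [e5, e1, mul_assoc]
    have h2 : A₁ = bᵀ * (g * C)ᵀ + bᵀ * S := by
      rw [e2, e4, transpose_neg, transpose_mul C b, neg_mul, neg_neg, transpose_mul g C, hg,
        mul_assoc]
    rw [mul_sub, mul_sub, ← h1, h2]
    abel
  have hbu : IsUnit bᵀ := by
    have h1 : bᵀ * (g * A⁻¹) = 1 := by rw [← mul_assoc, ← e1, hAi']
    exact IsUnit.of_mul_eq_one _ h1
  have e7 := (hbu.mul_right_eq_zero).mp e6
  exact sub_eq_zero.mp e7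

variable [FiniteDimensional ℝ E]

theorem hasDerivWithinAt_bilin (β : E →ₗ[ℝ] E →ₗ[ℝ] ℝ) {u w : ℝ → E} {u' w' : E}
    (hu : HasDerivWithinAt u u' J t) (hw : HasDerivWithinAt w w' J t) :
    HasDerivWithinAt (fun s => β (u s) (w s)) (β u' (w t) + β (u t) w') J t := by
  let B : E →L[ℝ] E →L[ℝ] ℝ := LinearMap.toContinuousBilinearMap β
  have h := (B.hasFDerivAt.comp_hasDerivWithinAt t hu).clm_apply hw
  exact h

theorem IsFrameNear.hasDerivWithinAt_gram (ht : t ∈ J) (h : IsFrameNear β Λ J t e e₁ e₂ H₀ H₁)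
    (v : Fin m → E) : HasDerivWithinAt (fun s => gram β v (e s)) (gram β v (e₁ t)) J t := by
  refine hasDerivWithinAt_matrix fun i j => ?_
  have := hasDerivWithinAt_bilin β (hasDerivWithinAt_const t J (v i))
    (h.deriv.self_of_nhdsWithin ht j)
  simpa [gram] using this

theorem IsFrameNear.hasDerivWithinAt_gram₁ (ht : t ∈ J) (h : IsFrameNear β Λ J t e e₁ e₂ H₀ H₁)
    (v : Fin m → E) : HasDerivWithinAt (fun s => gram β v (e₁ s))
      (gram β v (e t) * H₀ t + gram β v (e₁ t) * H₁ t) J t := by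
  refine hasDerivWithinAt_matrix fun i j => ?_
  have := hasDerivWithinAt_bilin β (hasDerivWithinAt_const t J (v i))
    (h.deriv₁.self_of_nhdsWithin ht j)
  refine this.congr_deriv ?_
  rw [h.eq.self_of_nhdsWithin ht j]
  simp [gram, Matrix.mul_apply, mul_comm]

/-- Differentiate the isotropy relation `β(e i, e j) = 0`. -/
theorem IsFrameNear.gram_symm (hβ : ∀ x, β x x = 0) (ht : t ∈ J) (hJ : UniqueDiffWithinAt ℝ J t)
    (h : IsFrameNear β Λ J t e e₁ e₂ H₀ H₁) :
    (gram β (e₁ t) (e t))ᵀ = gram β (e₁ t) (e t) := by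
  ext i j
  have hd := h.deriv.self_of_nhdsWithin ht
  have h1 := hasDerivWithinAt_bilin β (hd i) (hd j)
  have h2 : HasDerivWithinAt (fun s => β (e s i) (e s j)) 0 J t :=
    (hasDerivWithinAt_const t J (0 : ℝ)).congr_of_eventuallyEq
      (h.isotropic.mono fun s hs => hs i j) (h.isotropic.self_of_nhdsWithin ht i j)
  have h3 := hJ.eq_deriv _ h1 h2
  rw [apply_swap_of_alternating hβ (e t i)] at h3
  simp only [gram, transpose_apply, of_apply]
  linarith

/-- The skew part of `g H₁` is the form `β(e₁, e₁)`. -/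
theorem IsFrameNear.gram_mul_sub (hβ : ∀ x, β x x = 0) (ht : t ∈ J)
    (hJ : ∀ s ∈ J, UniqueDiffWithinAt ℝ J s) (h : IsFrameNear β Λ J t e e₁ e₂ H₀ H₁) :
    gram β (e₁ t) (e t) * H₁ t - (gram β (e₁ t) (e t) * H₁ t)ᵀ =
      (2 : ℝ) • gram β (e₁ t) (e₁ t) := by
  have hsymm : ∀ᶠ s in 𝓝[J] t, (gram β (e₁ s) (e s))ᵀ = gram β (e₁ s) (e s) := by
    filter_upwards [h.eventually, self_mem_nhdsWithin] with s hs hsJ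
    exact hs.gram_symm hβ hsJ (hJ s hsJ)
  have hg := hsymm.self_of_nhdsWithin ht
  have hiso := h.isotropic.self_of_nhdsWithin ht
  have hd := h.deriv.self_of_nhdsWithin ht
  have hd1 := h.deriv₁.self_of_nhdsWithin ht
  have he2 := h.eq.self_of_nhdsWithin ht
  have key : ∀ i j, β (e₂ t i) (e t j) = ((gram β (e₁ t) (e t) * H₁ t)ᵀ) i j := by
    intro i j
    conv_rhs => rw [← hg]
    rw [he2 i]
    simp [gram, Matrix.mul_apply, hiso, mul_comm]
  ext i j
  -- The symmetry of `β(e₁, e)` is differentiated: `β(e₂ i, e j) + β(e₁ i, e₁ j)` is symmetric in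
  -- `i`, `j`, and the first term is an entry of `(g H₁)ᵀ` because isotropy kills `H₀`.
  have h1 := hasDerivWithinAt_bilin β (hd1 i) (hd j)
  have h2 := hasDerivWithinAt_bilin β (hd1 j) (hd i)
  have h3 : HasDerivWithinAt (fun s => β (e₁ s i) (e s j))
      (β (e₂ t j) (e t i) + β (e₁ t j) (e₁ t i)) J t :=
    h2.congr_of_eventuallyEq (hsymm.mono fun s hs => congrFun (congrFun hs j) i)
      (congrFun (congrFun hg j) i)
  have h4 := (hJ t ht).eq_deriv _ h1 h3
  rw [key, key, apply_swap_of_alternating hβ (e₁ t j)] at h4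
  simp only [transpose_apply] at h4
  simp only [Matrix.sub_apply, transpose_apply, Matrix.smul_apply, smul_eq_mul]
  simp only [gram, of_apply] at h4 ⊢
  linarith

/-- The trace of `H₁ - 2 A⁻¹ A'`. -/
noncomputable def frameTrace (β : E →ₗ[ℝ] E →ₗ[ℝ] ℝ) (v : Fin m → E) (e e₁ : ℝ → Fin m → E)
    (H₁ : ℝ → Matrix (Fin m) (Fin m) ℝ) (s : ℝ) : ℝ :=
  (H₁ s).trace - 2 * ((gram β v (e s))⁻¹ * gram β v (e₁ s)).trace

theorem eventually_isUnit_gram (ht : t ∈ J) (h : IsFrameNear β Λ J t e e₁ e₂ H₀ H₁) {v : Fin m → E}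
    (hA : IsUnit (gram β v (e t))) : ∀ᶠ s in 𝓝[J] t, IsUnit (gram β v (e s)) :=
  (h.hasDerivWithinAt_gram ht v).continuousWithinAt (Units.isOpen.mem_nhds hA)

/-- `frameTrace` does not depend on the frame. -/
theorem frameTrace_eq (ht : t ∈ J) (hJ : ∀ s ∈ J, UniqueDiffWithinAt ℝ J s) {v : Fin m → E}
    (hβ : ∀ x, β x x = 0)
    (h : IsFrameNear β Λ J t e e₁ e₂ H₀ H₁) (h' : IsFrameNear β Λ J t e' e₁' e₂' H₀' H₁')
    (hA : IsUnit (gram β v (e t))) (hA' : IsUnit (gram β v (e' t))) :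
    frameTrace β v e' e₁' H₁' t = frameTrace β v e e₁ H₁ t := by
  -- the transition matrix
  set R : ℝ → Matrix (Fin m) (Fin m) ℝ := fun s => (gram β v (e s))⁻¹ * gram β v (e' s) with hR
  set R₁ : ℝ → Matrix (Fin m) (Fin m) ℝ := fun s =>
    (gram β v (e s))⁻¹ * (gram β v (e₁' s) - gram β v (e₁ s) * R s) with hR₁
  have hRd : ∀ᶠ s in 𝓝[J] t, HasDerivWithinAt R (R₁ s) J s := by
    filter_upwards [eventually_isUnit_gram ht h hA, h.eventually, h'.eventually,
      self_mem_nhdsWithin] with s hs h1 h2 hsJ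
    refine ((hasDerivWithinAt_matrix_inv (h1.hasDerivWithinAt_gram hsJ v) hs).mul
      (h2.hasDerivWithinAt_gram hsJ v)).congr_deriv ?_
    simp only [hR₁, hR, mul_sub, neg_mul, mul_assoc]
    abel
  have hRdt := hRd.self_of_nhdsWithin ht
  -- Only the existence of `R₂` matters: below it is multiplied by `gram β u (e t)`, which vanishes.
  obtain ⟨R₂, hR₂⟩ : ∃ R₂, HasDerivWithinAt R₁ R₂ J t :=
    ⟨_, (hasDerivWithinAt_matrix_inv (h.hasDerivWithinAt_gram ht v) hA).mul
      ((h'.hasDerivWithinAt_gram₁ ht v).sub ((h.hasDerivWithinAt_gram₁ ht v).mul hRdt))⟩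
  have hvec : ∀ᶠ s in 𝓝[J] t, ∀ u : Fin m → E, gram β u (e' s) = gram β u (e s) * R s := by
    filter_upwards [eventually_isUnit_gram ht h hA, h.span, h'.span] with s hs h1 h2
    have hmem : ∀ j, ∃ c : Fin m → ℝ, ∑ i, c i • e s i = e' s j := by
      intro j
      have : e' s j ∈ Submodule.span ℝ (range (e s)) := by
        rw [h1, ← h2]; exact Submodule.subset_span ⟨j, rfl⟩
      exact (Submodule.mem_span_range_iff_exists_fun ℝ).mp this
    choose c hc using hmem
    have hgen : ∀ u : Fin m → E, gram β u (e' s) = gram β u (e s) * Matrix.of (fun i j => c j i) := by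
      intro u
      ext i j
      rw [gram, of_apply, ← hc j]
      simp [gram, Matrix.mul_apply, mul_comm]
    have hRc : R s = Matrix.of (fun i j => c j i) := by
      rw [hR]
      simp only
      rw [hgen v, ← mul_assoc, nonsing_inv_mul _ ((isUnit_iff_isUnit_det _).mp hs), one_mul]
    intro u
    rw [hRc]
    exact hgen u
  -- Pairing with the frame frozen at time `t` kills all vectors of `Λ t`, while on first
  -- derivatives it is the invertible metric up to sign. This isolates the `H₁` terms in the second
  -- derivative of `e' = e R`.
  set u := e t with hu
  have hG : IsUnit (gram β u (e₁ t)) := by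
    have h1 := isUnit_of_definite (h.definite.self_of_nhdsWithin ht)
    have h2 : gram β u (e₁ t) = -(gram β (e₁ t) (e t))ᵀ := by
      ext i j
      simp only [gram, of_apply, Matrix.neg_apply, transpose_apply, hu]
      exact apply_swap_of_alternating hβ _ _
    rw [h2, IsUnit.neg_iff, isUnit_transpose]
    exact h1
  have hB0 : gram β u (e t) = 0 := by
    ext i j; exact h.isotropic.self_of_nhdsWithin ht i j
  have hB0' : gram β u (e' t) = 0 := by
    rw [hvec.self_of_nhdsWithin ht u, hB0, zero_mul]
  have hfirst : ∀ᶠ s in 𝓝[J] t,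
      gram β u (e₁' s) = gram β u (e₁ s) * R s + gram β u (e s) * R₁ s := by
    filter_upwards [hRd, h.eventually, h'.eventually, self_mem_nhdsWithin,
      eventually_eventually_nhdsWithin.mpr hvec] with s h1 h2 h3 hsJ h4
    have h5 := (h2.hasDerivWithinAt_gram hsJ u).mul h1
    have h6 := (h3.hasDerivWithinAt_gram hsJ u).congr_of_eventuallyEq
      (h4.mono fun r hr => (hr u).symm) (h4.self_of_nhdsWithin hsJ u).symm
    exact (hJ s hsJ).eq_deriv _ h6 h5
  have hsecond : gram β u (e₁' t) * H₁' t =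
      gram β u (e₁ t) * (H₁ t * R t + (2 : ℝ) • R₁ t) := by
    have h5 := ((h.hasDerivWithinAt_gram₁ ht u).mul hRdt).add
      ((h.hasDerivWithinAt_gram ht u).mul hR₂)
    have h6 := (h'.hasDerivWithinAt_gram₁ ht u).congr_of_eventuallyEq
      (hfirst.mono fun r hr => hr.symm) (hfirst.self_of_nhdsWithin ht).symm
    have h7 := (hJ t ht).eq_deriv _ h6 h5
    rw [hB0, hB0', zero_mul, zero_add, zero_mul, zero_add, zero_mul, add_zero] at h7
    rw [h7, mul_add, mul_smul_comm, two_smul, mul_assoc]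
    abel
  have hfirst' : gram β u (e₁' t) = gram β u (e₁ t) * R t := by
    rw [hfirst.self_of_nhdsWithin ht, hB0, zero_mul, add_zero]
  -- Under the change of frame `e' = e R`, both `H₁` and `2 A⁻¹ A'` are conjugated by `R` and gain
  -- the same term `2 R⁻¹ R₁`, which cancels in their difference.
  have hrel : R t * H₁' t = H₁ t * R t + (2 : ℝ) • R₁ t := by
    rw [hfirst', mul_assoc] at hsecond
    exact hG.mul_left_cancel hsecond
  have hAR : gram β v (e' t) = gram β v (e t) * R t := hvec.self_of_nhdsWithin ht v
  have hAi : (gram β v (e t))⁻¹ * gram β v (e t) = 1 :=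
    nonsing_inv_mul _ ((isUnit_iff_isUnit_det _).mp hA)
  have hAi' : gram β v (e t) * (gram β v (e t))⁻¹ = 1 :=
    mul_nonsing_inv _ ((isUnit_iff_isUnit_det _).mp hA)
  have hRu : IsUnit (R t) := by
    rw [hR]
    exact ((isUnit_nonsing_inv_iff).mpr hA).mul hA'
  have hRi : R t * (R t)⁻¹ = 1 := mul_nonsing_inv _ ((isUnit_iff_isUnit_det _).mp hRu)
  have hRi' : (R t)⁻¹ * R t = 1 := nonsing_inv_mul _ ((isUnit_iff_isUnit_det _).mp hRu)
  have hA1 : (gram β v (e t))⁻¹ * gram β v (e₁' t) =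
      R₁ t + (gram β v (e t))⁻¹ * gram β v (e₁ t) * R t := by
    simp only [hR₁, mul_sub, mul_assoc]
    abel
  have t1 : (H₁' t).trace = (H₁ t).trace + 2 * ((R t)⁻¹ * R₁ t).trace := by
    have : H₁' t = (R t)⁻¹ * (H₁ t * R t + (2 : ℝ) • R₁ t) := by
      rw [← hrel, ← mul_assoc, hRi', one_mul]
    rw [this, mul_add, mul_smul_comm, trace_add, trace_smul, trace_mul_comm, mul_assoc, hRi,
      mul_one, smul_eq_mul]
  have t2 : ((gram β v (e' t))⁻¹ * gram β v (e₁' t)).trace =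
      ((R t)⁻¹ * R₁ t).trace + ((gram β v (e t))⁻¹ * gram β v (e₁ t)).trace := by
    rw [hAR, Matrix.mul_inv_rev, mul_assoc, hA1, mul_add, trace_add]
    congr 1
    rw [trace_mul_comm, mul_assoc, hRi, mul_one]
  rw [frameTrace, frameTrace, t1, t2]
  ring

/-- A curve of isotropic subspaces on `[0, π m / √κ]` with definite metric and curvature trace at
least `κ` cannot be transversal to an isotropic subspace for all positive times. -/
theorem false_of_frames (hm : 0 < m) {κ : ℝ} (hκ : 0 < κ) (hβ : ∀ x, β x x = 0) {v : Fin m → E}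
    (hv : ∀ k l, β (v k) (v l) = 0) {b : ℝ} (hb : b = Real.pi * m / √κ)
    (hframe : ∀ t ∈ Ioc 0 b, ∃ (e e₁ e₂ : ℝ → Fin m → E)
      (H₀ H₁ : ℝ → Matrix (Fin m) (Fin m) ℝ) (H₁' : Matrix (Fin m) (Fin m) ℝ),
      IsFrameNear β Λ (Icc 0 b) t e e₁ e₂ H₀ H₁ ∧ HasDerivWithinAt H₁ H₁' (Icc 0 b) t ∧
      κ ≤ (-H₀ t + (1 / 2 : ℝ) • H₁' - (1 / 4 : ℝ) • (H₁ t * H₁ t)).trace ∧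
      IsUnit (gram β v (e t)) ∧ ∃ p q : Matrix (Fin m) (Fin m) ℝ,
        ∀ k, v k = ∑ i, p i k • e t i + ∑ i, q i k • e₁ t i) : False := by
  have hm0 : (0 : ℝ) < m := by exact_mod_cast hm
  have hb0 : 0 < b := by
    rw [hb]
    have := Real.pi_pos
    have := Real.sqrt_pos.mpr hκ
    positivity
  have hJ : ∀ s ∈ Icc 0 b, UniqueDiffWithinAt ℝ (Icc 0 b) s := uniqueDiffOn_Icc hb0
  have hframe' : ∀ t, ∃ (e e₁ e₂ : ℝ → Fin m → E)
      (H₀ H₁ : ℝ → Matrix (Fin m) (Fin m) ℝ) (H₁' : Matrix (Fin m) (Fin m) ℝ), t ∈ Ioc 0 b →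
      IsFrameNear β Λ (Icc 0 b) t e e₁ e₂ H₀ H₁ ∧ HasDerivWithinAt H₁ H₁' (Icc 0 b) t ∧
      κ ≤ (-H₀ t + (1 / 2 : ℝ) • H₁' - (1 / 4 : ℝ) • (H₁ t * H₁ t)).trace ∧
      IsUnit (gram β v (e t)) ∧ ∃ p q : Matrix (Fin m) (Fin m) ℝ,
        ∀ k, v k = ∑ i, p i k • e t i + ∑ i, q i k • e₁ t i := by
    intro t
    by_cases ht : t ∈ Ioc 0 b
    · obtain ⟨e, e₁, e₂, H₀, H₁, H₁', h⟩ := hframe t ht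
      exact ⟨e, e₁, e₂, H₀, H₁, H₁', fun _ => h⟩
    · exact ⟨fun _ _ => 0, fun _ _ => 0, fun _ _ => 0, 0, 0, 0, fun h => absurd h ht⟩
  choose e e₁ e₂ H₀ H₁ H₁' hF using hframe'
  -- The frame changes with `t`, so `h` uses at each time the frame chosen there. Frame independence
  -- makes `h` agree near `t` with the function of a single frame, hence differentiable.
  set h : ℝ → ℝ := fun t => frameTrace β v (e t) (e₁ t) (H₁ t) t with hh
  have hloc : ∀ t ∈ Ioc 0 b, h =ᶠ[𝓝[Icc 0 b] t] frameTrace β v (e t) (e₁ t) (H₁ t) := by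
    intro t ht
    obtain ⟨h1, -, -, h4, -⟩ := hF t ht
    have e1 : ∀ᶠ s in 𝓝[Icc 0 b] t, 0 < s := mem_nhdsWithin_of_mem_nhds (Ioi_mem_nhds ht.1)
    filter_upwards [e1, self_mem_nhdsWithin, h1.eventually,
      eventually_isUnit_gram (Ioc_subset_Icc_self ht) h1 h4] with s hs1 hs2 hs3 hs4
    obtain ⟨g1, -, -, g4, -⟩ := hF s ⟨hs1, hs2.2⟩
    exact frameTrace_eq hs2 hJ hβ hs3 g1 hs4 g4
  refine riccati_blowup hm hκ (h := h) (h' := fun t =>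
    2 * (-H₀ t t + (1 / 2 : ℝ) • H₁' t - (1 / 4 : ℝ) • (H₁ t t * H₁ t t)).trace +
        1 / 2 * ((H₁ t t - (2 : ℝ) • ((gram β v (e t t))⁻¹ * gram β v (e₁ t t))) *
          (H₁ t t - (2 : ℝ) • ((gram β v (e t t))⁻¹ * gram β v (e₁ t t)))).trace) ?_ ?_
  · rw [← hb]
    intro t ht
    have htJ := Ioc_subset_Icc_self ht
    obtain ⟨h1, h2, h3, h4, -⟩ := hF t ht
    exact (hasDerivWithinAt_trace_sub (A := fun s => gram β v (e t s))
      (A₁ := fun s => gram β v (e₁ t s)) (H₁ := H₁ t) (h1.hasDerivWithinAt_gram htJ v)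
      (h1.hasDerivWithinAt_gram₁ htJ v) h2 h4).congr_of_eventuallyEq (hloc t ht) rfl
  · rw [← hb]
    intro t ht
    have htJ := Ioc_subset_Icc_self ht
    obtain ⟨h1, h2, h3, h4, p, q, h5⟩ := hF t ht
    have hsym := h1.gram_symm hβ htJ (hJ t htJ)
    have k1 := h1.gram_mul_sub hβ htJ hJ
    have k2 := gram_mul_sub_of_isotropic hβ hv (h1.isotropic.self_of_nhdsWithin htJ) hsym h4 h5
    set g := gram β (e₁ t t) (e t t)
    set C := (gram β v (e t t))⁻¹ * gram β v (e₁ t t) with hC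
    -- The skew part of `g H₁` is twice that of `g C`, so `g (H₁ - 2 C)` is symmetric.
    have hN : (g * (H₁ t t - (2 : ℝ) • C))ᵀ = g * (H₁ t t - (2 : ℝ) • C) := by
      rw [mul_sub, mul_smul_comm, transpose_sub, transpose_smul]
      rw [← k2, sub_eq_iff_eq_add, ← sub_eq_iff_eq_add'] at k1
      rw [← k1, smul_sub]
      abel
    have k3 := sq_trace_le_of_definite hm (h1.definite.self_of_nhdsWithin htJ) hsym hN
    have k4 : h t = (H₁ t t - (2 : ℝ) • C).trace := by
      rw [hh, trace_sub, trace_smul, smul_eq_mul]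
      rfl
    rw [k4]
    have k5 : (H₁ t t - (2 : ℝ) • C).trace ^ 2 / (2 * m) =
        1 / 2 * ((H₁ t t - (2 : ℝ) • C).trace ^ 2 / m) := by field_simp
    rw [k5]
    linarith

end Frames
end DynamicPair

namespace DynamicPair
open Set Metric Topology NNReal VectorField Filter

/-! ### Propagation along an interval by Grönwall's inequality -/

section Propagation

/-- A property which is locally equivalent to the vanishing of a solution of a linear differential
inequality propagates along an interval. -/
theorem forall_of_local_gronwall {F : Type*} [NormedAddCommGroup F] [NormedSpace ℝ F] {b : ℝ}
    {Z : ℝ → Prop} (h : ∀ t ∈ Icc 0 b, ∃ (y y' : ℝ → F) (C : ℝ), ∀ᶠ s in 𝓝[Icc 0 b] t,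
      HasDerivWithinAt y (y' s) (Icc 0 b) s ∧ ‖y' s‖ ≤ C * ‖y s‖ ∧ (Z s ↔ y s = 0))
    (h0 : Z 0) : ∀ t ∈ Icc 0 b, Z t := by
  -- The set of good times is closed by continuity of the local functions `y`, and it extends to the
  -- right because a solution of `‖y'‖ ≤ C ‖y‖` that vanishes once vanishes afterwards.
  refine IsClosed.Icc_subset_of_forall_mem_nhdsWithin (s := {t | Z t}) ?_ h0 ?_
  · refine isClosed_of_closure_subset fun x hx => ?_
    have hxJ : x ∈ Icc 0 b := isClosed_Icc.closure_subset_iff.mpr inter_subset_right hx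
    obtain ⟨y, y', C, hy⟩ := h x hxJ
    obtain ⟨h1, -, h3⟩ := hy.self_of_nhdsWithin hxJ
    refine ⟨h3.mpr ?_, hxJ⟩
    have hf : ∃ᶠ s in 𝓝[Icc 0 b] x, y s = 0 := by
      have h4 : ∃ᶠ s in 𝓝[Icc 0 b] x, Z s := by
        rw [frequently_nhdsWithin_iff]
        exact mem_closure_iff_frequently.mp hx
      exact (h4.and_eventually hy).mono fun s hs => hs.2.2.2.mp hs.1
    exact isClosed_singleton.mem_of_frequently_of_tendsto hf h1.continuousWithinAt
  · rintro x ⟨hxZ, hx0, hxb⟩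
    obtain ⟨y, y', C, hy⟩ := h x ⟨hx0, hxb.le⟩
    obtain ⟨δ, hδ, hball⟩ := Metric.mem_nhdsWithin_iff.mp hy
    have key : ∀ t ∈ Ioo x (min (x + δ) b), Z t := by
      intro t ht
      have ht1 : t < x + δ := ht.2.trans_le (min_le_left _ _)
      have ht2 : t < b := ht.2.trans_le (min_le_right _ _)
      have hin : ∀ s ∈ Icc x t, HasDerivWithinAt y (y' s) (Icc 0 b) s ∧
          ‖y' s‖ ≤ C * ‖y s‖ ∧ (Z s ↔ y s = 0) := by
        intro s hs
        refine hball ⟨?_, hx0.trans hs.1, hs.2.trans ht2.le⟩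
        rw [mem_ball, Real.dist_eq, abs_of_nonneg (by linarith [hs.1])]
        linarith [hs.2]
      have hz := eq_zero_of_abs_deriv_le_mul_abs_self_of_eq_zero_right (f := y) (f' := y') (K := C)
        (a := x) (b := t) ?_ ?_ ?_ (fun s hs => (hin s (Ico_subset_Icc_self hs)).2.1) t
        ⟨ht.1.le, le_rfl⟩
      · exact (hin t ⟨ht.1.le, le_rfl⟩).2.2.mpr hz
      · intro s hs
        exact (hin s hs).1.continuousWithinAt.mono
          (Icc_subset_Icc hx0 ht2.le)
      · intro s hs
        refine (hin s (Ico_subset_Icc_self hs)).1.mono_of_mem_nhdsWithin ?_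
        filter_upwards [self_mem_nhdsWithin,
          mem_nhdsWithin_of_mem_nhds (Iio_mem_nhds (hs.2.trans ht2))] with r hr hr'
        exact ⟨(hx0.trans hs.1).trans hr, le_of_lt hr'⟩
      · exact (hin x ⟨le_rfl, ht.1.le⟩).2.2.mp hxZ
    exact mem_of_superset (Ioo_mem_nhdsGT (lt_min (by linarith) hxb)) key

end Propagation

/-! ### Smoothness and bracket rules for sections -/

section Smooth

variable {E : Type*} [NormedAddCommGroup E] [NormedSpace ℝ E]
  {M : Type*} [TopologicalSpace M] [ChartedSpace E M]

theorem hasDerivWithinAt_comp_integralCurve {X : ∀ x : M, TangentSpace 𝓘(ℝ, E) x} {c : ℝ → M}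
    {J : Set ℝ} (hc : IsMIntegralCurveOn c X J) {t : ℝ} (ht : t ∈ J) {f : M → ℝ}
    (hf : MDifferentiableAt 𝓘(ℝ, E) 𝓘(ℝ, ℝ) f (c t)) :
    HasDerivWithinAt (fun s => f (c s)) (derivAlong X f (c t)) J t := by
  have h1 := hf.hasMFDerivAt.comp_hasMFDerivWithinAt t (hc t ht)
  let D : E →L[ℝ] ℝ := mfderiv 𝓘(ℝ, E) 𝓘(ℝ, ℝ) f (c t)
  let v : E := X (c t)
  have h2 : HasFDerivWithinAt (fun s => f (c s)) (D.comp ((1 : ℝ →L[ℝ] ℝ).smulRight v)) J t :=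
    hasMFDerivWithinAt_iff_hasFDerivWithinAt.mp h1
  refine h2.hasDerivWithinAt.congr_deriv ?_
  change D ((1 : ℝ) • v) = D v
  rw [one_smul]

open scoped Matrix.Norms.Operator in
theorem contMDiffAt_matrix_inv {ι : Type*} [Fintype ι] [DecidableEq ι]
    {G : M → Matrix ι ι ℝ} {x : M}
    (hG : ∀ a b, ContMDiffAt 𝓘(ℝ, E) 𝓘(ℝ, ℝ) ∞ (fun y => G y a b) x) (hx : IsUnit (G x)) (a b : ι) :
    ContMDiffAt 𝓘(ℝ, E) 𝓘(ℝ, ℝ) ∞ (fun y => (G y)⁻¹ a b) x := by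
  let L : (ι → ι → ℝ) →L[ℝ] Matrix ι ι ℝ :=
    LinearMap.toContinuousLinearMap (Matrix.ofLinearEquiv ℝ).toLinearMap
  let L' : Matrix ι ι ℝ →L[ℝ] ℝ := LinearMap.toContinuousLinearMap (Matrix.entryLinearMap ℝ ℝ a b)
  have h1 : ContMDiffAt 𝓘(ℝ, E) 𝓘(ℝ, ι → ι → ℝ) ∞ (fun y a b => G y a b) x :=
    contMDiffAt_pi_space.mpr fun a => contMDiffAt_pi_space.mpr fun b => hG a b
  obtain ⟨u, hu⟩ := hx
  have h2 : ContDiffAt ℝ ∞ (Ring.inverse : Matrix ι ι ℝ → _) (L fun a b => G x a b) := by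
    change ContDiffAt ℝ ∞ (Ring.inverse : Matrix ι ι ℝ → _) (G x)
    rw [← hu]; exact contDiffAt_ringInverse ℝ u
  have h3 : ContDiffAt ℝ ∞ (fun A => L' (Ring.inverse (L A))) fun a b => G x a b :=
    L'.contDiff.contDiffAt.comp _ (h2.comp _ L.contDiff.contDiffAt)
  refine (h3.comp_contMDiffAt h1).congr_of_eventuallyEq (Eventually.of_forall fun y => ?_)
  change (G y)⁻¹ a b = (Ring.inverse (G y)) a b
  rw [Matrix.nonsing_inv_eq_ringInverse]

theorem bracket_congr {X Y Z : ∀ x : M, TangentSpace 𝓘(ℝ, E) x} {U : Set M} (hU : IsOpen U)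
    (h : ∀ x ∈ U, Z x = Y x) {x : M} (hx : x ∈ U) : bracket X Z x = bracket X Y x :=
  Filter.EventuallyEq.mlieBracket_vectorField_eq EventuallyEq.rfl
    (mem_of_superset (hU.mem_nhds hx) h)

variable [IsManifold 𝓘(ℝ, E) ∞ M]

theorem IsSmoothOn.mdifferentiableAt {Y : ∀ x : M, TangentSpace 𝓘(ℝ, E) x} {U : Set M}
    (hY : IsSmoothOn Y U) (hU : IsOpen U) {x : M} (hx : x ∈ U) :
    MDifferentiableAt 𝓘(ℝ, E) 𝓘(ℝ, E).tangent
      (fun x => (⟨x, Y x⟩ : TangentBundle 𝓘(ℝ, E) M)) x :=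
  (hY.contMDiffAt hU hx).mdifferentiableAt (by simp)

theorem IsSmoothOn.sum_smul {ι : Type*} {Y : ι → ∀ x : M, TangentSpace 𝓘(ℝ, E) x} {U : Set M}
    (hY : ∀ i, IsSmoothOn (Y i) U) (s : Finset ι) (a : ι → ℝ) :
    IsSmoothOn (fun x => ∑ i ∈ s, a i • Y i x) U :=
  ContMDiffOn.sum_section fun i _ => (hY i).const_smul_section

theorem bracket_sum_smul [CompleteSpace E] {ι : Type*} [DecidableEq ι]
    {X : ∀ x : M, TangentSpace 𝓘(ℝ, E) x} {Y : ι → ∀ x : M, TangentSpace 𝓘(ℝ, E) x} {U : Set M} (hU : IsOpen U)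
    (hY : ∀ i, IsSmoothOn (Y i) U) {x : M} (hx : x ∈ U) (s : Finset ι) (a : ι → ℝ) :
    bracket X (fun x => ∑ i ∈ s, a i • Y i x) x = ∑ i ∈ s, a i • bracket X (Y i) x := by
  have : IsManifold 𝓘(ℝ, E) (minSmoothness ℝ 2) M := by
    rw [minSmoothness_of_isRCLikeNormedField]
    exact IsManifold.of_le (n := ∞) ENat.LEInfty.out
  induction s using Finset.induction_on with
  | empty =>
    simp only [Finset.sum_empty]
    exact congrFun (mlieBracket_zero_right (I := 𝓘(ℝ, E)) (W := X)) x
  | insert i s hi ih =>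
    rw [Finset.sum_insert hi, ← ih]
    have h1 : (fun x => ∑ j ∈ insert i s, a j • Y j x) =
        (a i • Y i) + fun x => ∑ j ∈ s, a j • Y j x := by
      funext y
      rw [Finset.sum_insert hi]
      rfl
    rw [h1]
    have h2 := (hY i).mdifferentiableAt hU hx
    have h3 := (IsSmoothOn.sum_smul hY s a).mdifferentiableAt hU hx
    have h4 : IsSmoothOn (a i • Y i) U := (hY i).const_smul_section
    rw [bracket, mlieBracket_add_right (h4.mdifferentiableAt hU hx) h3,
      mlieBracket_const_smul_right h2]

theorem IsSmoothOn.congr {Y Z : ∀ x : M, TangentSpace 𝓘(ℝ, E) x} {U : Set M}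
    (hY : IsSmoothOn Y U) (h : ∀ x ∈ U, Z x = Y x) : IsSmoothOn Z U :=
  ContMDiffOn.congr hY fun x hx => by rw [h x hx]

end Smooth

end DynamicPair

namespace DynamicPair
open Set Metric Topology NNReal VectorField Filter

theorem bilin_sum_smul_left {E ι : Type*} [AddCommGroup E] [Module ℝ E] [Fintype ι]
    (β : E →ₗ[ℝ] E →ₗ[ℝ] ℝ) (h : ι → ℝ) (u : ι → E) (w : E) :
    β (∑ a, h a • u a) w = ∑ a, h a * β (u a) w := by
  simp

theorem bilin_sum_smul_right {E ι : Type*} [AddCommGroup E] [Module ℝ E] [Fintype ι]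
    (β : E →ₗ[ℝ] E →ₗ[ℝ] ℝ) (h : ι → ℝ) (u : ι → E) (w : E) :
    β w (∑ a, h a • u a) = ∑ a, h a * β w (u a) := by
  simp

/-! ### The form `σ` on fields with values in `𝒟` -/

namespace RegularSemiHamiltonianQuadruple

variable {E : Type*} [NormedAddCommGroup E] [NormedSpace ℝ E]
  {M : Type*} [TopologicalSpace M] [ChartedSpace E M] [IsManifold 𝓘(ℝ, E) ∞ M]
  {m : ℕ} (Q : RegularSemiHamiltonianQuadruple E M m)

/-- A linear projection of the tangent space onto `𝒟 x`. -/
noncomputable def proj (x : M) : TangentSpace 𝓘(ℝ, E) x →ₗ[ℝ] Q.𝒟 x :=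
  (LinearMap.exists_leftInverse_of_injective (Q.𝒟 x).subtype (Submodule.ker_subtype _)).choose

theorem proj_apply {x : M} {u : TangentSpace 𝓘(ℝ, E) x} (hu : u ∈ Q.𝒟 x) :
    Q.proj x u = ⟨u, hu⟩ :=
  LinearMap.congr_fun (LinearMap.exists_leftInverse_of_injective (Q.𝒟 x).subtype
    (Submodule.ker_subtype _)).choose_spec ⟨u, hu⟩

/-- The form `σ x`, extended to the whole tangent space. -/
noncomputable def form (x : M) : E →ₗ[ℝ] E →ₗ[ℝ] ℝ :=
  (Q.σ x).compl₁₂ (Q.proj x) (Q.proj x)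

theorem form_apply {x : M} {u w : TangentSpace 𝓘(ℝ, E) x} (hu : u ∈ Q.𝒟 x) (hw : w ∈ Q.𝒟 x) :
    Q.form x u w = Q.σ x ⟨u, hu⟩ ⟨w, hw⟩ := by
  rw [← Q.proj_apply hu, ← Q.proj_apply hw]
  rfl

theorem form_self (x : M) (u : E) : Q.form x u u = 0 := Q.alt_σ x _

theorem eq_zero_of_form {x : M} {u : TangentSpace 𝓘(ℝ, E) x} (hu : u ∈ Q.𝒟 x)
    (h : ∀ w ∈ Q.𝒟 x, Q.form x u w = 0) : u = 0 := by
  have h1 : (⟨u, hu⟩ : Q.𝒟 x) = 0 := (Q.nondegenerate_σ x).1 _ fun w => by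
    rw [← h w w.2, Q.form_apply hu w.2]
  exact congrArg Subtype.val h1

theorem form_eq_zero_of_mem_𝒱 {x : M} {u w : TangentSpace 𝓘(ℝ, E) x} (hu : u ∈ Q.𝒱 x)
    (hw : w ∈ Q.𝒱 x) : Q.form x u w = 0 := by
  rw [Q.form_apply (Q.𝒱_le_𝒟 x hu) (Q.𝒱_le_𝒟 x hw)]
  exact Q.lagrangian x ⟨u, hu⟩ ⟨w, hw⟩

/-- `Y` is smooth on `U` and takes values in `𝒟` there. -/
def IsSectionOn (Y : ∀ x : M, TangentSpace 𝓘(ℝ, E) x) (U : Set M) : Prop :=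
  IsSmoothOn Y U ∧ ∀ x ∈ U, Y x ∈ Q.𝒟 x

/-- The section of `𝒟` defined by projecting a vector field. -/
noncomputable def toSection (Y : ∀ x : M, TangentSpace 𝓘(ℝ, E) x) : ∀ x, Q.𝒟 x :=
  fun x => Q.proj x (Y x)

variable {Q} {Y Z : ∀ x : M, TangentSpace 𝓘(ℝ, E) x} {U : Set M}

theorem IsSectionOn.toField_eq (hY : Q.IsSectionOn Y U) {x : M} (hx : x ∈ U) :
    toField (Q.toSection Y) x = Y x := by
  rw [toField, toSection, Q.proj_apply (hY.2 x hx)]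

theorem IsSectionOn.smooth (hY : Q.IsSectionOn Y U) : IsSmoothOn (toField (Q.toSection Y)) U :=
  hY.1.congr fun _ hx => hY.toField_eq hx

theorem IsSectionOn.bracket_mem (hY : Q.IsSectionOn Y U) (hU : IsOpen U) {x : M} (hx : x ∈ U) :
    bracket Q.X Y x ∈ Q.𝒟 x := by
  rw [← bracket_congr hU (fun _ hx => hY.toField_eq hx) hx]
  exact Q.bracket_mem U hU _ hY.smooth x hx

theorem IsSectionOn.bracket [CompleteSpace E] (hY : Q.IsSectionOn Y U) (hU : IsOpen U) :
    Q.IsSectionOn (bracket Q.X Y) U :=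
  ⟨IsSmoothOn.bracket (ContMDiffOn.mono Q.smooth_X (subset_univ U)) hY.1 hU, fun _ hx => hY.bracket_mem hU hx⟩

theorem IsSectionOn.contMDiffAt (hY : Q.IsSectionOn Y U) (hZ : Q.IsSectionOn Z U) (hU : IsOpen U)
    {x : M} (hx : x ∈ U) :
    ContMDiffAt 𝓘(ℝ, E) 𝓘(ℝ, ℝ) ∞ (fun y => Q.form y (Y y) (Z y)) x :=
  (Q.smooth_σ U hU _ _ hY.smooth hZ.smooth).contMDiffAt (hU.mem_nhds hx)

/-- The axiom on `σ` concerns sections with values in `𝒟` everywhere, whereas iterated brackets lie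
in `𝒟` only on `U`. Projecting to `𝒟` changes nothing on `U`, and brackets are local. -/
theorem IsSectionOn.derivAlong_form (hY : Q.IsSectionOn Y U) (hZ : Q.IsSectionOn Z U)
    (hU : IsOpen U) {x : M} (hx : x ∈ U) :
    derivAlong Q.X (fun y => Q.form y (Y y) (Z y)) x =
      Q.form x (DynamicPair.bracket Q.X Y x) (Z x) +
        Q.form x (Y x) (DynamicPair.bracket Q.X Z x) := by
  refine (Q.invariant_σ U hU _ _ hY.smooth hZ.smooth x hx).trans ?_
  rw [Q.form_apply (hY.bracket_mem hU hx) (hZ.2 x hx),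
    Q.form_apply (hY.2 x hx) (hZ.bracket_mem hU hx)]
  have e1 : Q.toSection Y x = ⟨Y x, hY.2 x hx⟩ := Q.proj_apply _
  have e2 : Q.toSection Z x = ⟨Z x, hZ.2 x hx⟩ := Q.proj_apply _
  have e3 := bracket_congr (X := Q.X) hU (fun _ hx => hY.toField_eq hx) hx
  have e4 := bracket_congr (X := Q.X) hU (fun _ hx => hZ.toField_eq hx) hx
  simp only [e1, e2, e3, e4]

theorem IsSectionOn.hasDerivWithinAt_form (hY : Q.IsSectionOn Y U) (hZ : Q.IsSectionOn Z U)
    (hU : IsOpen U) {c : ℝ → M} {J : Set ℝ} (hc : IsMIntegralCurveOn c Q.X J) {t : ℝ} (ht : t ∈ J)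
    (htU : c t ∈ U) :
    HasDerivWithinAt (fun s => Q.form (c s) (Y (c s)) (Z (c s)))
      (Q.form (c t) (DynamicPair.bracket Q.X Y (c t)) (Z (c t)) +
        Q.form (c t) (Y (c t)) (DynamicPair.bracket Q.X Z (c t))) J t := by
  rw [← hY.derivAlong_form hZ hU htU]
  exact hasDerivWithinAt_comp_integralCurve hc ht
    ((hY.contMDiffAt hZ hU htU).mdifferentiableAt (by simp))

/-- The coefficients of a section with respect to a frame with invertible Gram matrix are smooth. -/
theorem contMDiffAt_coeff {ι : Type*} [Fintype ι] [DecidableEq ι]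
    {Y : ι → ∀ x : M, TangentSpace 𝓘(ℝ, E) x} (hY : ∀ a, Q.IsSectionOn (Y a) U)
    (hZ : Q.IsSectionOn Z U) (hU : IsOpen U) {x : M} (hx : x ∈ U)
    (hG : IsUnit (Matrix.of fun a b => Q.form x (Y b x) (Y a x))) {h : M → ι → ℝ}
    (hh : ∀ y ∈ U, Z y = ∑ a, h y a • Y a y) (a : ι) :
    ContMDiffAt 𝓘(ℝ, E) 𝓘(ℝ, ℝ) ∞ (fun y => h y a) x := by
  set G : M → Matrix ι ι ℝ := fun y => Matrix.of fun a b => Q.form y (Y b y) (Y a y) with hGdef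
  have hGs : ∀ y ∈ U, ∀ a b, ContMDiffAt 𝓘(ℝ, E) 𝓘(ℝ, ℝ) ∞ (fun y => G y a b) y :=
    fun y hy a b => (hY b).contMDiffAt (hY a) hU hy
  have hev : ∀ᶠ y in 𝓝 x, IsUnit (G y) := by
    have h1 : ContinuousAt (fun y => (G y).det) x := by
      have h2 : ContinuousAt G x := continuousAt_pi.mpr fun a => continuousAt_pi.mpr fun b =>
        (hGs x hx a b).continuousAt
      exact (Continuous.matrix_det continuous_id).continuousAt.comp h2
    have h2 : (G x).det ≠ 0 := ((Matrix.isUnit_iff_isUnit_det _).mp hG).ne_zero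
    filter_upwards [h1.eventually_ne h2] with y hy
    exact (Matrix.isUnit_iff_isUnit_det _).mpr (isUnit_iff_ne_zero.mpr hy)
  -- The coefficients solve a linear system whose matrix is the Gram matrix and whose right-hand
  -- side is the pairing of `Z` with the frame, both smooth.
  have key : ContMDiffAt 𝓘(ℝ, E) 𝓘(ℝ, ℝ) ∞
      (fun y => ∑ b, (G y)⁻¹ a b * Q.form y (Z y) (Y b y)) x :=
    contMDiffAt_finsetSum fun b _ => (contMDiffAt_matrix_inv (hGs x hx) hG a b).mul
      (hZ.contMDiffAt (hY b) hU hx)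
  refine key.congr_of_eventuallyEq ?_
  filter_upwards [hev, hU.mem_nhds hx] with y hy hyU
  have h1 : (fun b => Q.form y (Z y) (Y b y)) = (G y).mulVec (h y) := by
    funext b
    refine (congrArg (fun z : E => Q.form y z (Y b y)) (hh y hyU)).trans ?_
    refine (bilin_sum_smul_left (Q.form y) (h y) (fun a => Y a y) (Y b y)).trans ?_
    exact Finset.sum_congr rfl fun a _ => mul_comm _ _
  have h2 : (G y)⁻¹.mulVec (fun b => Q.form y (Z y) (Y b y)) = h y := by
    rw [h1, Matrix.mulVec_mulVec, Matrix.nonsing_inv_mul _ ((Matrix.isUnit_iff_isUnit_det _).mp hy),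
      Matrix.one_mulVec]
  exact (congrFun h2 a).symm

end RegularSemiHamiltonianQuadruple

end DynamicPair

namespace DynamicPair
open Set Metric Topology NNReal VectorField Filter

theorem map_sum_smul_eq {ι E F : Type*} [Fintype ι] [NormedAddCommGroup E]
    [NormedSpace ℝ E] [NormedAddCommGroup F] [NormedSpace ℝ F]
    (L : E →L[ℝ] F) (h : ι → ℝ) (u : ι → E) : L (∑ a, h a • u a) = ∑ a, h a • L (u a) := by
  simp

theorem norm_sum_smul_le {F ι : Type*} [NormedAddCommGroup F] [NormedSpace ℝ F] [Fintype ι]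
    {h : ι → ℝ} {y : ι → F} {C D : ℝ} (hC : ∑ b, |h b| ≤ C) (hD : 0 ≤ D) (hy : ∀ b, ‖y b‖ ≤ D) :
    ‖∑ b, h b • y b‖ ≤ C * D := by
  calc ‖∑ b, h b • y b‖ ≤ ∑ b, ‖h b • y b‖ := norm_sum_le _ _
    _ ≤ ∑ b, |h b| * D := Finset.sum_le_sum fun b _ => by
        rw [norm_smul, Real.norm_eq_abs]
        exact mul_le_mul_of_nonneg_left (hy b) (abs_nonneg _)
    _ = (∑ b, |h b|) * D := by rw [Finset.sum_mul]
    _ ≤ C * D := mul_le_mul_of_nonneg_right hC hD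

/-! ### Invariance of `𝒟` and `σ` under the flow -/

namespace RegularSemiHamiltonianQuadruple

variable {E : Type*} [NormedAddCommGroup E] [NormedSpace ℝ E] [FiniteDimensional ℝ E]
  {M : Type*} [TopologicalSpace M] [ChartedSpace E M] [IsManifold 𝓘(ℝ, E) ∞ M]
  {m : ℕ} (Q : RegularSemiHamiltonianQuadruple E M m)

/-- The plane `𝒟 x` as a subspace of the model space. -/
def planeD (x : M) : Submodule ℝ E := Q.𝒟 x

/-- Around each point of an integral curve there is a frame of `𝒟` on which `[X, ·]` acts by a
matrix which is bounded along the curve. -/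
theorem exists_frame_bracket_eq {c : ℝ → M} {J : Set ℝ} (hc : IsMIntegralCurveOn c Q.X J) {t : ℝ}
    (ht : t ∈ J) : ∃ (U : Set M) (Y : Fin (2 * m) → ∀ x : M, TangentSpace 𝓘(ℝ, E) x)
      (B : M → Matrix (Fin (2 * m)) (Fin (2 * m)) ℝ) (C : ℝ), IsOpen U ∧
      (∀ a, Q.IsSectionOn (Y a) U) ∧
      (∀ y ∈ U, ∀ u ∈ Q.𝒟 y, ∃ h : Fin (2 * m) → ℝ, u = ∑ a, h a • Y a y) ∧
      (∀ y ∈ U, ∀ a, bracket Q.X (Y a) y = ∑ b, B y b a • Y b y) ∧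
      ∀ᶠ s in 𝓝[J] t, c s ∈ U ∧ ∀ a, ∑ b, |B (c s) b a| ≤ C := by
  have hE : CompleteSpace E := FiniteDimensional.complete ℝ E
  obtain ⟨U, hU, hxU, V, hV⟩ := Q.distribution_𝒟 (c t)
  have hsec : ∀ a, Q.IsSectionOn (toField (V a)) U := fun a => ⟨hV.smooth a, fun y _ => (V a y).2⟩
  have hspan : ∀ y ∈ U, ∀ u ∈ Q.𝒟 y, ∃ h : Fin (2 * m) → ℝ, u = ∑ a, h a • toField (V a) y := by
    intro y hy u hu
    have h1 : (⟨u, hu⟩ : Q.𝒟 y) ∈ Submodule.span ℝ (range fun i => V i y) := by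
      rw [hV.span_eq_top y hy]; trivial
    obtain ⟨h, hh⟩ := (Submodule.mem_span_range_iff_exists_fun ℝ).mp h1
    refine ⟨h, ?_⟩
    have h2 := congrArg Subtype.val hh
    rw [Submodule.coe_sum] at h2
    exact h2.symm
  have hB : ∀ y a, ∃ h : Fin (2 * m) → ℝ, y ∈ U →
      bracket Q.X (toField (V a)) y = ∑ b, h b • toField (V b) y := by
    intro y a
    by_cases hy : y ∈ U
    · obtain ⟨h, hh⟩ := hspan y hy _ ((hsec a).bracket_mem hU hy)
      exact ⟨h, fun _ => hh⟩
    · exact ⟨0, fun h => absurd h hy⟩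
  choose B hB using hB
  -- Nondegeneracy of `σ`: a kernel vector of the Gram matrix gives a vector of `𝒟` orthogonal to
  -- all of `𝒟`.
  have hG : IsUnit (Matrix.of fun a b =>
      Q.form (c t) (toField (V b) (c t)) (toField (V a) (c t))) := by
    rw [← Matrix.mulVec_injective_iff_isUnit]
    refine (injective_iff_map_eq_zero (Matrix.mulVecLin _)).mpr fun h hh => ?_
    let v : Fin (2 * m) → E := fun a => toField (V a) (c t)
    have h1 : ∀ a, Q.form (c t) (∑ b, h b • v b) (v a) = 0 := by
      intro a
      rw [bilin_sum_smul_left]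
      exact (Finset.sum_congr rfl fun b _ => mul_comm _ _).trans (congrFun hh a)
    have hmem : (∑ b, h b • V b (c t)) = ⟨∑ b, h b • v b, by
        exact Submodule.sum_mem (Q.𝒟 (c t)) fun b _ =>
          Submodule.smul_mem _ _ (V b (c t)).2⟩ := by
      apply Subtype.ext
      rw [Submodule.coe_sum]
      rfl
    have h2 : (∑ b, h b • V b (c t)) = 0 := by
      rw [hmem]
      apply Subtype.ext
      refine Q.eq_zero_of_form (Subtype.mem _) fun w hw => ?_
      obtain ⟨k, hk⟩ := hspan _ hxU w hw
      refine (congrArg (fun z : E => Q.form (c t) (∑ b, h b • v b) z) hk).trans ?_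
      refine (bilin_sum_smul_right _ k v _).trans ?_
      exact Finset.sum_eq_zero fun a _ => by rw [h1 a, mul_zero]
    funext a
    exact Fintype.linearIndependent_iff.mp (hV.linearIndependent _ hxU) h h2 a
  have hcont : ∀ a b, ContinuousWithinAt (fun s => B (c s) a b) J t := by
    intro a b
    have h1 := contMDiffAt_coeff hsec ((hsec a).bracket hU) hU hxU hG
      (h := fun y b => B y a b) (fun y hy => hB y a hy) b
    exact h1.continuousAt.comp_continuousWithinAt (f := c) (hc t ht).continuousWithinAt
  -- The sum of the absolute values of all entries is continuous along `c`, so near `t` it stays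
  -- below its value at `t` plus one.
  refine ⟨U, fun a => toField (V a), fun y => Matrix.of fun b a => B y a b,
    1 + ∑ a, ∑ b, |B (c t) a b|, hU, hsec, hspan, fun y hy a => hB y a hy, ?_⟩
  have h2 : ContinuousWithinAt (fun s => ∑ a, ∑ b, |B (c s) a b|) J t :=
    tendsto_finsetSum _ fun a _ => tendsto_finsetSum _ fun b _ => (hcont a b).abs
  have h3 : ∀ᶠ s in 𝓝[J] t, ∑ a, ∑ b, |B (c s) a b| < 1 + ∑ a, ∑ b, |B (c t) a b| :=
    h2.eventually (Iio_mem_nhds (by linarith))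
  filter_upwards [h3, (hc t ht).continuousWithinAt (hU.mem_nhds hxU)] with s hs hsU
  refine ⟨hsU, fun a => le_trans ?_ hs.le⟩
  exact Finset.single_le_sum (f := fun a => ∑ b, |B (c s) a b|)
    (fun i _ => Finset.sum_nonneg fun j _ => abs_nonneg _) (Finset.mem_univ a)

variable {Q} {c : ℝ → M} {b : ℝ} {R : ℝ → E →L[ℝ] E}

/-- Pulled back frame vectors, and the values of `σ` on the frame, satisfy linear differential
equations with locally bounded coefficients. This is the input for `forall_of_local_gronwall`. -/
theorem exists_frame_along (hc : IsMIntegralCurveOn c Q.X (Icc 0 b))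
    (hR : ∀ t ∈ Icc 0 b, ∀ Y U, IsOpen U → c t ∈ U → IsSmoothOn Y U →
      HasDerivWithinAt (fun s => R s (Y (c s))) (R t (bracket Q.X Y (c t))) (Icc 0 b) t)
    {t : ℝ} (ht : t ∈ Icc 0 b) : ∃ (y : Fin (2 * m) → ℝ → E)
      (B : ℝ → Matrix (Fin (2 * m)) (Fin (2 * m)) ℝ) (C : ℝ), 0 ≤ C ∧ ∀ᶠ s in 𝓝[Icc 0 b] t,
      (∀ a, y a s ∈ Q.planeD (c s)) ∧
      (∀ u ∈ Q.planeD (c s), ∃ h : Fin (2 * m) → ℝ, u = ∑ a, h a • y a s) ∧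
      (∀ a, HasDerivWithinAt (fun r => R r (y a r)) (∑ d, B s d a • R s (y d s)) (Icc 0 b) s) ∧
      (∀ a d, HasDerivWithinAt (fun r => Q.form (c r) (y a r) (y d r))
        (∑ k, B s k a * Q.form (c s) (y k s) (y d s) + ∑ k, B s k d * Q.form (c s) (y a s) (y k s))
        (Icc 0 b) s) ∧ ∀ a, ∑ d, |B s d a| ≤ C := by
  obtain ⟨U, Y, B, C, hU, hsec, hspan, hbr, hev⟩ := Q.exists_frame_bracket_eq hc ht
  refine ⟨fun a s => Y a (c s), fun s => B (c s), max C 0, le_max_right _ _, ?_⟩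
  filter_upwards [hev, self_mem_nhdsWithin] with s hs hsJ
  refine ⟨fun a => (hsec a).2 _ hs.1, hspan _ hs.1, fun a => ?_, fun a d => ?_,
    fun a => (hs.2 a).trans (le_max_left _ _)⟩
  · refine (hR s hsJ (Y a) U hU hs.1 (hsec a).1).congr_deriv ?_
    exact (congrArg (fun z : E => R s z) (hbr _ hs.1 a)).trans
      (map_sum_smul_eq (R s) _ fun d => (Y d (c s) : E))
  · refine ((hsec a).hasDerivWithinAt_form (hsec d) hU hc hsJ hs.1).congr_deriv ?_
    exact congrArg₂ (· + ·)
      ((congrArg (fun w : E => Q.form (c s) w (Y d (c s))) (hbr _ hs.1 a)).trans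
        (bilin_sum_smul_left _ _ (fun k => (Y k (c s) : E)) _))
      ((congrArg (fun w : E => Q.form (c s) (Y a (c s)) w) (hbr _ hs.1 d)).trans
        (bilin_sum_smul_right _ _ (fun k => (Y k (c s) : E)) _))

/-- The pull back of `𝒟` along the flow is `𝒟`. -/
theorem transport_mem_planeD (hc : IsMIntegralCurveOn c Q.X (Icc 0 b)) (hR0 : ∀ v, R 0 v = v)
    (hR : ∀ t ∈ Icc 0 b, ∀ Y U, IsOpen U → c t ∈ U → IsSmoothOn Y U →
      HasDerivWithinAt (fun s => R s (Y (c s))) (R t (bracket Q.X Y (c t))) (Icc 0 b) t) :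
    ∀ t ∈ Icc 0 b, ∀ u ∈ Q.planeD (c t), R t u ∈ Q.planeD (c 0) := by
  -- `q` is a projection with kernel `𝒟 (c 0)`. The images `q (R s (y a s))` solve a linear system,
  -- and their vanishing says that `R s` maps `𝒟 (c s)` into `𝒟 (c 0)`.
  obtain ⟨q, hq⟩ : ∃ q : E →L[ℝ] E, ∀ u : E, q u = 0 ↔ u ∈ Q.planeD (c 0) := by
    obtain ⟨S, hS⟩ := (Q.planeD (c 0)).exists_isCompl
    refine ⟨LinearMap.toContinuousLinearMap (S.projection _ hS.symm), fun u => ?_⟩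
    exact Submodule.projection_apply_eq_zero_iff hS.symm
  refine forall_of_local_gronwall (F := Fin (2 * m) → E) ?_ ?_
  · intro t ht
    obtain ⟨y, B, C, hC, hev⟩ := exists_frame_along hc hR ht
    refine ⟨fun s a => q (R s (y a s)), fun s a => ∑ d, B s d a • q (R s (y d s)), C, ?_⟩
    filter_upwards [hev] with s hs
    obtain ⟨h1, h2, h3, -, h5⟩ := hs
    refine ⟨hasDerivWithinAt_pi.mpr fun a => ?_, ?_, ?_⟩
    · refine (q.hasFDerivAt.comp_hasDerivWithinAt s (h3 a)).congr_deriv ?_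
      exact map_sum_smul_eq q _ _
    · refine (pi_norm_le_iff_of_nonneg (mul_nonneg hC (norm_nonneg _))).mpr fun a => ?_
      exact norm_sum_smul_le (y := fun d => q (R s (y d s))) (h5 a) (norm_nonneg _)
        fun d => norm_le_pi_norm (fun a => q (R s (y a s))) d
    · constructor
      · intro h
        funext a
        exact (hq _).mpr (h _ (h1 a))
      · intro h u hu
        obtain ⟨k, rfl⟩ := h2 u hu
        rw [← hq, map_sum_smul_eq, map_sum_smul_eq]
        refine Finset.sum_eq_zero fun a _ => ?_
        rw [show q (R s (y a s)) = 0 from congrFun h a, smul_zero]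
  · intro u hu
    rwa [hR0]

/-- The pull back of `σ` along the flow is `σ`. -/
theorem form_transport (hc : IsMIntegralCurveOn c Q.X (Icc 0 b)) (hR0 : ∀ v, R 0 v = v)
    (hR : ∀ t ∈ Icc 0 b, ∀ Y U, IsOpen U → c t ∈ U → IsSmoothOn Y U →
      HasDerivWithinAt (fun s => R s (Y (c s))) (R t (bracket Q.X Y (c t))) (Icc 0 b) t) :
    ∀ t ∈ Icc 0 b, ∀ u ∈ Q.planeD (c t), ∀ w ∈ Q.planeD (c t),
      Q.form (c t) u w = Q.form (c 0) (R t u) (R t w) := by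
  refine forall_of_local_gronwall (F := Fin (2 * m) × Fin (2 * m) → ℝ) ?_ ?_
  · intro t ht
    obtain ⟨y, B, C, hC, hev⟩ := exists_frame_along hc hR ht
    -- Both terms solve the same linear system, one by invariance of `σ`, the other by bilinearity
    -- of the fixed form; hence so does their difference.
    let f : ℝ → Fin (2 * m) × Fin (2 * m) → ℝ := fun s a =>
      Q.form (c s) (y a.1 s) (y a.2 s) - Q.form (c 0) (R s (y a.1 s)) (R s (y a.2 s))
    refine ⟨f, fun s a => ∑ d, B s d a.1 • f s (d, a.2) + ∑ d, B s d a.2 • f s (a.1, d),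
      C + C, ?_⟩
    filter_upwards [hev] with s hs
    obtain ⟨h1, h2, h3, h4, h5⟩ := hs
    refine ⟨hasDerivWithinAt_pi.mpr fun a => ?_, ?_, ?_⟩
    · refine ((h4 a.1 a.2).sub
        (hasDerivWithinAt_bilin (Q.form (c 0)) (h3 a.1) (h3 a.2))).congr_deriv ?_
      rw [bilin_sum_smul_left, bilin_sum_smul_right]
      simp only [f, smul_eq_mul, mul_sub, Finset.sum_sub_distrib]
      ring
    · refine (pi_norm_le_iff_of_nonneg
        (mul_nonneg (add_nonneg hC hC) (norm_nonneg _))).mpr fun a => ?_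
      rw [add_mul]
      exact (norm_add_le _ _).trans (add_le_add
        (norm_sum_smul_le (h5 a.1) (norm_nonneg _) fun d => norm_le_pi_norm (f s) (d, a.2))
        (norm_sum_smul_le (h5 a.2) (norm_nonneg _) fun d => norm_le_pi_norm (f s) (a.1, d)))
    · constructor
      · intro h
        funext a
        exact sub_eq_zero.mpr (h _ (h1 a.1) _ (h1 a.2))
      · intro h u hu w hw
        obtain ⟨k, rfl⟩ := h2 u hu
        obtain ⟨l, rfl⟩ := h2 w hw
        have hy : ∀ a d, Q.form (c s) (y a s) (y d s) =
          Q.form (c 0) (R s (y a s)) (R s (y d s)) := fun a d =>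
            sub_eq_zero.mp (congrFun h (a, d))
        simp only [map_sum_smul_eq, bilin_sum_smul_left, bilin_sum_smul_right, hy]
  · intro u hu w hw
    rw [hR0, hR0]

end RegularSemiHamiltonianQuadruple

end DynamicPair

namespace DynamicPair
open Set Metric Topology NNReal VectorField Filter

/-! ### Gram matrices of isotropic families -/

section Isotropic

variable {E : Type*} [NormedAddCommGroup E] [NormedSpace ℝ E] {m : ℕ}
  {β : E →ₗ[ℝ] E →ₗ[ℝ] ℝ} {v w : Fin m → E}

/-- The block of `v` against `v` vanishes, and the off-diagonal blocks are, up to sign and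
transposition, the invertible matrix `gram β w v`. The system is solved first for the `w` part, then
for the `v` part. -/
theorem isUnit_gram_sumElim (hβ : ∀ x, β x x = 0) (hv : ∀ i j, β (v i) (v j) = 0)
    (hg : IsUnit (gram β w v)) :
    IsUnit (Matrix.of fun a b => β (Sum.elim v w b) (Sum.elim v w a)) := by
  rw [← Matrix.mulVec_injective_iff_isUnit]
  refine (injective_iff_map_eq_zero (Matrix.mulVecLin _)).mpr fun h hh => ?_
  have hrow : ∀ a, ∑ j, β (v j) (Sum.elim v w a) * h (Sum.inl j) +
      ∑ j, β (w j) (Sum.elim v w a) * h (Sum.inr j) = 0 := by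
    intro a
    have := congrFun hh a
    simpa [Matrix.mulVec, dotProduct, Fintype.sum_sum_type] using this
  have h1 : (fun j => h (Sum.inr j)) = 0 := by
    refine Matrix.mulVec_injective_of_isUnit ((Matrix.isUnit_transpose _).mpr hg) ?_
    rw [Matrix.mulVec_zero]
    funext i
    have := hrow (Sum.inl i)
    simpa [hv, Matrix.mulVec, dotProduct, gram] using this
  have h1' : ∀ j, h (Sum.inr j) = 0 := congrFun h1
  have h2 : (fun j => h (Sum.inl j)) = 0 := by
    refine Matrix.mulVec_injective_of_isUnit hg ?_
    rw [Matrix.mulVec_zero]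
    funext i
    have := hrow (Sum.inr i)
    simp only [Sum.elim_inr, h1', mul_zero, Finset.sum_const_zero, add_zero] at this
    simp only [apply_swap_of_alternating hβ (v _) (w i), neg_mul, Finset.sum_neg_distrib,
      neg_eq_zero] at this
    exact this
  funext a
  rcases a with j | j
  · exact congrFun h2 j
  · exact h1' j

theorem linearIndependent_of_isUnit_gram {ι : Type*} [Fintype ι] [DecidableEq ι] {u : ι → E}
    (hu : IsUnit (Matrix.of fun a b => β (u b) (u a))) : LinearIndependent ℝ u := by
  rw [Fintype.linearIndependent_iff]
  intro h hh
  have h1 : (Matrix.of fun a b => β (u b) (u a)).mulVec h = 0 := by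
    funext a
    have h2 := bilin_sum_smul_left β h u (u a)
    rw [hh, map_zero, LinearMap.zero_apply] at h2
    rw [Pi.zero_apply, h2]
    exact Finset.sum_congr rfl fun b _ => mul_comm _ _
  exact congrFun (Matrix.mulVec_injective_of_isUnit hu (h1.trans (Matrix.mulVec_zero _).symm))

end Isotropic

/-! ### Curvature and metric in a frame -/

section Frame

variable {E : Type*} [NormedAddCommGroup E] [NormedSpace ℝ E]
  {M : Type*} [TopologicalSpace M] [ChartedSpace E M] [IsManifold 𝓘(ℝ, E) ∞ M]

theorem IsFrameOn.finrank_eq {m : ℕ} {𝒱 : ∀ x : M, Submodule ℝ (TangentSpace 𝓘(ℝ, E) x)}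
    {V : Fin m → ∀ x, 𝒱 x} {U : Set M} (hV : IsFrameOn 𝒱 V U) {x : M} (hx : x ∈ U) :
    Module.finrank ℝ (𝒱 x) = m := by
  rw [Module.finrank_eq_card_basis
    (Module.Basis.mk (hV.linearIndependent x hx) (hV.span_eq_top x hx).ge), Fintype.card_fin]

theorem trace_eq_of_isFrameOn {m : ℕ} {𝒱 : ∀ x : M, Submodule ℝ (TangentSpace 𝓘(ℝ, E) x)}
    {V : Fin m → ∀ x, 𝒱 x} {U : Set M} (hV : IsFrameOn 𝒱 V U) {x : M} (hx : x ∈ U)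
    {K : 𝒱 x →ₗ[ℝ] 𝒱 x} {A : Matrix (Fin m) (Fin m) ℝ}
    (hK : ∀ j, K (V j x) = ∑ i, A i j • V i x) : LinearMap.trace ℝ (𝒱 x) K = A.trace := by
  let e := Module.Basis.mk (hV.linearIndependent x hx) (hV.span_eq_top x hx).ge
  have he : ∀ i, e i = V i x := fun i => Module.Basis.mk_apply _ _ i
  rw [LinearMap.trace_eq_matrix_trace ℝ e]
  congr 1
  ext i j
  rw [LinearMap.toMatrix_apply, he, hK]
  simp only [← he, map_sum, map_smul, Module.Basis.repr_self]
  simp [Finsupp.single_apply]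

end Frame

namespace RegularSemiHamiltonianQuadruple

variable {E : Type*} [NormedAddCommGroup E] [NormedSpace ℝ E]
  {M : Type*} [TopologicalSpace M] [ChartedSpace E M] [IsManifold 𝓘(ℝ, E) ∞ M]
  {m : ℕ} (Q : RegularSemiHamiltonianQuadruple E M m)

/-- The plane `𝒱 x` as a subspace of the model space. -/
def planeV (x : M) : Submodule ℝ E := Q.𝒱 x

theorem finrank_planeD (x : M) : Module.finrank ℝ (Q.planeD x) = 2 * m := by
  obtain ⟨U, -, hx, V, hV⟩ := Q.distribution_𝒟 x
  exact hV.finrank_eq hx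

/-- A positive trace rules out the default value `0` of `curvature`. The size of the frame in
`IsCurvatureAt` is forced to be `m` by the rank of `𝒱`. -/
theorem exists_frame_curvature {x : M}
    (h : 0 < LinearMap.trace ℝ (Q.𝒱 x) (curvature Q.X Q.𝒱 x)) :
    ∃ (U : Set M) (V : Fin m → ∀ y, Q.𝒱 y) (H₀ H₁ : M → Matrix (Fin m) (Fin m) ℝ),
      IsOpen U ∧ x ∈ U ∧ IsFrameOn Q.𝒱 V U ∧
      (∀ y ∈ U, ∀ j, bracket Q.X (bracket Q.X (toField (V j))) y =
        ∑ i, H₀ y i j • toField (V i) y + ∑ i, H₁ y i j • bracket Q.X (toField (V i)) y) ∧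
      LinearMap.trace ℝ (Q.𝒱 x) (curvature Q.X Q.𝒱 x) = (-H₀ x
        + (1 / 2 : ℝ) • Matrix.of (fun a b => derivAlong Q.X (fun y => H₁ y a b) x)
        - (1 / 4 : ℝ) • (H₁ x * H₁ x)).trace := by
  have hK : ∃ K : Q.𝒱 x →ₗ[ℝ] Q.𝒱 x, IsCurvatureAt Q.X Q.𝒱 x K := by
    by_contra hK
    rw [curvature, dif_neg hK, map_zero] at h
    exact lt_irrefl _ h
  have hcurv : IsCurvatureAt Q.X Q.𝒱 x (curvature Q.X Q.𝒱 x) := by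
    rw [curvature, dif_pos hK]
    exact hK.choose_spec
  obtain ⟨m', U, V, H₀, H₁, hU, hx, hV, hbr, hK'⟩ := hcurv
  obtain rfl : m' = m := by
    obtain ⟨U', -, hx', V', hV'⟩ := Q.distribution_𝒱 x
    rw [← hV.finrank_eq hx, hV'.finrank_eq hx']
  exact ⟨U, V, H₀, H₁, hU, hx, hV, hbr, trace_eq_of_isFrameOn hV hx hK'⟩

variable {Q} {U : Set M} {V : Fin m → ∀ y, Q.𝒱 y}

theorem metric_eq (hU : IsOpen U) (V W : ∀ y, Q.𝒱 y) (hV : IsSmoothOn (toField V) U) {x : M}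
    (hx : x ∈ U) :
    Q.metric hU V W hV hx = Q.form x (bracket Q.X (toField V) x) (toField W x) :=
  (Q.form_apply (Q.bracket_mem U hU (Q.incl V) hV x hx) (Q.𝒱_le_𝒟 x (W x).2)).symm

/-- The section is a combination of the frame with constant coefficients, so its bracket with `X`
has no derivative terms. -/
theorem metric_sum [CompleteSpace E] (hU : IsOpen U) (hV : IsFrameOn Q.𝒱 V U) {x : M} (hx : x ∈ U)
    (a : Fin m → ℝ) (ha : a ≠ 0) : ∃ (W : ∀ y, Q.𝒱 y) (hW : IsSmoothOn (toField W) U), W x ≠ 0 ∧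
      Q.metric hU W W hW hx = dotProduct a ((gram (Q.form x)
        (fun i => bracket Q.X (toField (V i)) x) (fun i => toField (V i) x)).mulVec a) := by
  have e : (toField fun y => ∑ i, a i • V i y) = fun y => ∑ i, a i • toField (V i) y := by
    funext y
    rw [toField, Submodule.coe_sum]
    rfl
  have hW : IsSmoothOn (toField fun y => ∑ i, a i • V i y) U := by
    rw [e]; exact IsSmoothOn.sum_smul hV.smooth _ a
  refine ⟨fun y => ∑ i, a i • V i y, hW, fun h0 => ha ?_, ?_⟩
  · funext i
    exact Fintype.linearIndependent_iff.mp (hV.linearIndependent x hx) a h0 i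
  · rw [metric_eq]
    have h2 := bracket_sum_smul (X := Q.X) hU hV.smooth hx Finset.univ a
    rw [← e] at h2
    refine (congrArg₂ (fun z z' : E => Q.form x z z') h2 (congrFun e x)).trans ?_
    refine (bilin_sum_smul_left _ a (fun i => (bracket Q.X (toField (V i)) x : E)) _).trans ?_
    refine Finset.sum_congr rfl fun i _ => congrArg (a i * ·) ?_
    refine (bilin_sum_smul_right _ a (fun i => (toField (V i) x : E)) _).trans ?_
    exact Finset.sum_congr rfl fun j _ => mul_comm _ _

theorem gram_definite [CompleteSpace E] (hU : IsOpen U) (hV : IsFrameOn Q.𝒱 V U) {x : M}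
    (hx : x ∈ U) (h : Q.MetricPosDefAt x ∨ Q.MetricNegDefAt x) :
    (∀ a, a ≠ 0 → 0 < dotProduct a ((gram (Q.form x)
        (fun i => bracket Q.X (toField (V i)) x) (fun i => toField (V i) x)).mulVec a)) ∨
    ∀ a, a ≠ 0 → dotProduct a ((gram (Q.form x)
        (fun i => bracket Q.X (toField (V i)) x) (fun i => toField (V i) x)).mulVec a) < 0 := by
  refine h.imp (fun h a ha => ?_) fun h a ha => ?_
  · obtain ⟨W, hW, hW0, hWa⟩ := metric_sum hU hV hx a ha
    rw [← hWa]
    exact h U hU hx W hW hW0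
  · obtain ⟨W, hW, hW0, hWa⟩ := metric_sum hU hV hx a ha
    rw [← hWa]
    exact h U hU hx W hW hW0

theorem span_eq_planeV (hV : IsFrameOn Q.𝒱 V U) {x : M} (hx : x ∈ U) :
    Submodule.span ℝ (range fun i => (toField (V i) x : E)) = Q.planeV x := by
  have h := congrArg (Submodule.map (Q.𝒱 x).subtype) (hV.span_eq_top x hx)
  rw [Submodule.map_span, Submodule.map_top, Submodule.range_subtype, ← range_comp] at h
  exact h

theorem isSectionOn_of_isFrameOn (hV : IsFrameOn Q.𝒱 V U) (i : Fin m) :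
    Q.IsSectionOn (toField (V i)) U :=
  ⟨hV.smooth i, fun x _ => Q.𝒱_le_𝒟 x (V i x).2⟩

/-- At a time which is not conjugate, the plane `𝒱` and its image under the flow are
transversal. -/
theorem eq_zero_of_not_isConjugateTime {c : ℝ → M} {t : ℝ} (ht : 0 < t)
    (hfl : flow Q.X t (c 0) = c t) {P : E →L[ℝ] E}
    (hP : ∀ v, P v = mfderiv 𝓘(ℝ, E) 𝓘(ℝ, E) (flow Q.X t) (c 0) v)
    (h : ¬IsConjugateTime Q.X Q.𝒱 c t) (u : E) (hu : u ∈ Q.planeV (c 0))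
    (hPu : P u ∈ Q.planeV (c t)) : P u = 0 := by
  have h1 : (Q.𝒱 (c 0)).map (mfderiv 𝓘(ℝ, E) 𝓘(ℝ, E) (flow Q.X t) (c 0)).toLinearMap ⊓
      Q.𝒱 (flow Q.X t (c 0)) = ⊥ := by
    by_contra h2
    exact h ⟨ht, h2⟩
  have h2 : mfderiv 𝓘(ℝ, E) 𝓘(ℝ, E) (flow Q.X t) (c 0) u ∈
      (Q.𝒱 (c 0)).map (mfderiv 𝓘(ℝ, E) 𝓘(ℝ, E) (flow Q.X t) (c 0)).toLinearMap ⊓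
      Q.𝒱 (flow Q.X t (c 0)) := by
    refine ⟨⟨u, hu, rfl⟩, ?_⟩
    have h3 : ∀ y, y = c t → ∀ w : E, w ∈ Q.planeV (c t) → w ∈ Q.planeV y := by
      rintro _ rfl w hw
      exact hw
    exact h3 _ hfl _ (hP u ▸ hPu)
  rw [h1] at h2
  exact (hP u).trans h2

end RegularSemiHamiltonianQuadruple

end DynamicPair

namespace DynamicPair
open Set Metric Topology NNReal VectorField Filter

/-! ### The frames pulled back along an integral curve -/

namespace RegularSemiHamiltonianQuadruple

variable {E : Type*} [NormedAddCommGroup E] [NormedSpace ℝ E] [FiniteDimensional ℝ E]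
  {M : Type*} [TopologicalSpace M] [ChartedSpace E M] [IsManifold 𝓘(ℝ, E) ∞ M]
  {m : ℕ} {Q : RegularSemiHamiltonianQuadruple E M m} {U : Set M} {V : Fin m → ∀ y, Q.𝒱 y}

theorem isUnit_gram_frame (hU : IsOpen U) (hV : IsFrameOn Q.𝒱 V U) {x : M}
    (hx : x ∈ U) (h : Q.MetricPosDefAt x ∨ Q.MetricNegDefAt x) :
    IsUnit (Matrix.of fun a b => Q.form x
      (Sum.elim (fun i => (toField (V i) x : E)) (fun i => bracket Q.X (toField (V i)) x) b)
      (Sum.elim (fun i => (toField (V i) x : E)) (fun i => bracket Q.X (toField (V i)) x) a)) := by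
  have hE : CompleteSpace E := FiniteDimensional.complete ℝ E
  exact isUnit_gram_sumElim (Q.form_self x)
    (fun i j => Q.form_eq_zero_of_mem_𝒱 (V i x).2 (V j x).2)
    (isUnit_of_definite (gram_definite hU hV hx h))

/-- By definiteness of the metric the `2 m` vectors `V i`, `[X, V i]` are independent; they lie in
`𝒟`, which has rank `2 m`. -/
theorem exists_eq_sum_of_mem_planeD (hU : IsOpen U) (hV : IsFrameOn Q.𝒱 V U) {x : M}
    (hx : x ∈ U) (h : Q.MetricPosDefAt x ∨ Q.MetricNegDefAt x) {u : E} (hu : u ∈ Q.planeD x) :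
    ∃ p q : Fin m → ℝ, u = ∑ i, p i • (toField (V i) x : E) +
      ∑ i, q i • (bracket Q.X (toField (V i)) x : E) := by
  set y : Fin m ⊕ Fin m → E :=
    Sum.elim (fun i => toField (V i) x) (fun i => bracket Q.X (toField (V i)) x) with hy
  have hli : LinearIndependent ℝ y :=
    linearIndependent_of_isUnit_gram (isUnit_gram_frame hU hV hx h)
  have hle : Submodule.span ℝ (range y) ≤ Q.planeD x := by
    rw [Submodule.span_le]
    rintro _ ⟨a | a, rfl⟩
    · exact (isSectionOn_of_isFrameOn hV a).2 x hx
    · exact (isSectionOn_of_isFrameOn hV a).bracket_mem hU hx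
  have heq : Submodule.span ℝ (range y) = Q.planeD x := by
    refine Submodule.eq_of_le_of_finrank_eq hle ?_
    rw [finrank_span_eq_card hli, Q.finrank_planeD, Fintype.card_sum, Fintype.card_fin, two_mul]
  rw [← heq] at hu
  obtain ⟨k, rfl⟩ := (Submodule.mem_span_range_iff_exists_fun ℝ).mp hu
  refine ⟨fun i => k (Sum.inl i), fun i => k (Sum.inr i), ?_⟩
  rw [Fintype.sum_sum_type]
  rfl

/-- In `IsCurvatureAt` the matrices are arbitrary functions. Their smoothness comes from uniqueness
of coefficients in the frame `V i`, `[X, V i]` of `𝒟`, and it is needed to differentiate `H₁` along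
`c`. -/
theorem contMDiffAt_bracket_coeff (hU : IsOpen U) (hV : IsFrameOn Q.𝒱 V U) {x : M}
    (hx : x ∈ U) (h : Q.MetricPosDefAt x ∨ Q.MetricNegDefAt x)
    {H₀ H₁ : M → Matrix (Fin m) (Fin m) ℝ}
    (hbr : ∀ y ∈ U, ∀ j, bracket Q.X (bracket Q.X (toField (V j))) y =
        ∑ i, H₀ y i j • toField (V i) y + ∑ i, H₁ y i j • bracket Q.X (toField (V i)) y)
    (i j : Fin m) : ContMDiffAt 𝓘(ℝ, E) 𝓘(ℝ, ℝ) ∞ (fun y => H₁ y i j) x := by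
  have hE : CompleteSpace E := FiniteDimensional.complete ℝ E
  have hsec := isSectionOn_of_isFrameOn hV
  have hY : ∀ a, Q.IsSectionOn (Sum.elim (fun i => toField (V i))
      (fun i => bracket Q.X (toField (V i))) a) U := by
    rintro (a | a)
    · exact hsec a
    · exact (hsec a).bracket hU
  refine contMDiffAt_coeff hY (((hsec j).bracket hU).bracket hU) hU hx ?_
    (h := fun y => Sum.elim (fun i => H₀ y i j) (fun i => H₁ y i j)) ?_ (Sum.inr i)
  · refine (congrArg IsUnit (Matrix.ext fun a b => ?_)).mpr (isUnit_gram_frame hU hV hx h)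
    rcases a with a | a <;> rcases b with b | b <;> rfl
  · intro y hy
    rw [hbr y hy j, Fintype.sum_sum_type]
    rfl

variable {c : ℝ → M} {b : ℝ} {R : ℝ → E →L[ℝ] E}

/-- The frames and the curvature of a quadruple, pulled back along an integral curve. -/
theorem exists_isFrameNear (hc : IsMIntegralCurveOn c Q.X (Icc 0 b))
    (hR0 : ∀ v, R 0 v = v)
    (hR : ∀ t ∈ Icc 0 b, ∀ Y U, IsOpen U → c t ∈ U → IsSmoothOn Y U →
      HasDerivWithinAt (fun s => R s (Y (c s))) (R t (bracket Q.X Y (c t))) (Icc 0 b) t)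
    (hinj : ∀ t ∈ Icc 0 b, Function.Injective (R t))
    (hdef : ∀ t ∈ Icc 0 b, Q.MetricPosDefAt (c t) ∨ Q.MetricNegDefAt (c t)) {κ : ℝ} (hκ : 0 < κ)
    {t : ℝ} (ht : t ∈ Icc 0 b)
    (htr : κ ≤ LinearMap.trace ℝ (Q.𝒱 (c t)) (curvature Q.X Q.𝒱 (c t))) :
    ∃ (e e₁ e₂ : ℝ → Fin m → E) (H₀ H₁ : ℝ → Matrix (Fin m) (Fin m) ℝ)
      (H₁' : Matrix (Fin m) (Fin m) ℝ),
      IsFrameNear (Q.form (c 0)) (fun s => (Q.planeV (c s)).map (R s).toLinearMap) (Icc 0 b) t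
        e e₁ e₂ H₀ H₁ ∧
      HasDerivWithinAt H₁ H₁' (Icc 0 b) t ∧
      κ ≤ (-H₀ t + (1 / 2 : ℝ) • H₁' - (1 / 4 : ℝ) • (H₁ t * H₁ t)).trace ∧
      ∀ u ∈ Q.planeD (c 0), ∃ p q : Fin m → ℝ, u = ∑ i, p i • e t i + ∑ i, q i • e₁ t i := by
  have hE : CompleteSpace E := FiniteDimensional.complete ℝ E
  obtain ⟨U, V, H₀, H₁, hU, hx, hV, hbr, hK⟩ := Q.exists_frame_curvature (hκ.trans_le htr)
  have hsec := isSectionOn_of_isFrameOn hV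
  have hev : ∀ᶠ s in 𝓝[Icc 0 b] t, s ∈ Icc 0 b ∧ c s ∈ U :=
    eventually_and.mpr ⟨self_mem_nhdsWithin, (hc t ht).continuousWithinAt (hU.mem_nhds hx)⟩
  have hform := form_transport hc hR0 hR
  let v : ℝ → Fin m → E := fun s i => toField (V i) (c s)
  let w : ℝ → Fin m → E := fun s i => bracket Q.X (toField (V i)) (c s)
  have hvD : ∀ s, ∀ i, v s i ∈ Q.planeD (c s) := fun s i => Q.𝒱_le_𝒟 _ (V i (c s)).2
  have hwD : ∀ s, c s ∈ U → ∀ i, w s i ∈ Q.planeD (c s) := fun s hs i => (hsec i).bracket_mem hU hs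
  refine ⟨fun s i => R s (v s i), fun s i => R s (w s i),
    fun s i => R s (bracket Q.X (bracket Q.X (toField (V i))) (c s)), fun s => H₀ (c s),
    fun s => H₁ (c s), Matrix.of (fun i j => derivAlong Q.X (fun y => H₁ y i j) (c t)),
    ⟨?_, ?_, ?_, ?_, ?_, ?_⟩, ?_, ?_, ?_⟩
  · filter_upwards [hev] with s hs i
    exact hR s hs.1 _ U hU hs.2 (hsec i).1
  · filter_upwards [hev] with s hs i
    exact hR s hs.1 _ U hU hs.2 ((hsec i).bracket hU).1
  · filter_upwards [hev] with s hs j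
    refine (congrArg (fun z : E => R s z) (hbr _ hs.2 j)).trans ?_
    refine ((R s).map_add (∑ i, H₀ (c s) i j • v s i) (∑ i, H₁ (c s) i j • w s i)).trans ?_
    rw [map_sum_smul_eq, map_sum_smul_eq]
  · filter_upwards [hev] with s hs
    have h1 : Submodule.span ℝ (range (v s)) = Q.planeV (c s) := span_eq_planeV hV hs.2
    rw [← h1, Submodule.map_span, ← range_comp]
    rfl
  · filter_upwards [hev] with s hs i j
    rw [← hform s hs.1 _ (hvD s i) _ (hvD s j)]
    exact Q.form_eq_zero_of_mem_𝒱 (V i (c s)).2 (V j (c s)).2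
  · filter_upwards [hev] with s hs
    have h1 : gram (Q.form (c 0)) (fun i => R s (w s i)) (fun i => R s (v s i)) =
        gram (Q.form (c s)) (w s) (v s) := by
      ext i j
      exact (hform s hs.1 _ (hwD s hs.2 i) _ (hvD s j)).symm
    rw [h1]
    exact gram_definite hU hV hs.2 (hdef s hs.1)
  · refine hasDerivWithinAt_matrix fun i j => ?_
    exact hasDerivWithinAt_comp_integralCurve hc ht (f := fun y => H₁ y i j)
      ((contMDiffAt_bracket_coeff hU hV hx (hdef t ht) hbr i j).mdifferentiableAt (by simp))
  · exact htr.trans_eq hK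
  · intro u hu
    -- The inclusion is the invariance of `𝒟`; equality follows from injectivity of `R t` and equal
    -- dimensions.
    have hmap : (Q.planeD (c t)).map (R t).toLinearMap = Q.planeD (c 0) := by
      refine Submodule.eq_of_le_of_finrank_eq ?_ ?_
      · rintro _ ⟨z, hz, rfl⟩
        exact transport_mem_planeD hc hR0 hR t ht z hz
      · rw [← (Submodule.equivMapOfInjective (R t).toLinearMap (hinj t ht)
          (Q.planeD (c t))).finrank_eq, Q.finrank_planeD, Q.finrank_planeD]
    rw [← hmap] at hu
    obtain ⟨z, hz, rfl⟩ := hu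
    obtain ⟨p, q, hpq⟩ := exists_eq_sum_of_mem_planeD hU hV hx (hdef t ht) hz
    refine ⟨p, q, ?_⟩
    refine (congrArg (fun z : E => R t z) hpq).trans ?_
    refine ((R t).map_add (∑ i, p i • v t i) (∑ i, q i • w t i)).trans ?_
    rw [map_sum_smul_eq, map_sum_smul_eq]

end RegularSemiHamiltonianQuadruple

/-! ### Maximality of Lagrangian subspaces and transversality -/

section Maximality

variable {E : Type*} [NormedAddCommGroup E] [NormedSpace ℝ E] {m : ℕ}
  {β : E →ₗ[ℝ] E →ₗ[ℝ] ℝ} {v w : Fin m → E}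

/-- A vector in the span of `v`, `w` which is orthogonal to the isotropic family `v` lies in the
span of `v`. -/
theorem mem_span_of_orthogonal (hβ : ∀ x, β x x = 0) (hv : ∀ i j, β (v i) (v j) = 0)
    (hg : IsUnit (gram β w v)) {p q : Fin m → ℝ}
    (h : ∀ k, β (v k) (∑ i, p i • v i + ∑ i, q i • w i) = 0) :
    ∑ i, p i • v i + ∑ i, q i • w i ∈ Submodule.span ℝ (range v) := by
  have hq : q = 0 := by
    refine Matrix.mulVec_injective_of_isUnit ((Matrix.isUnit_transpose _).mpr hg) ?_
    rw [Matrix.mulVec_zero]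
    funext k
    have h1 := h k
    rw [map_add, bilin_sum_smul_right, bilin_sum_smul_right] at h1
    simp only [hv, mul_zero, Finset.sum_const_zero, zero_add, apply_swap_of_alternating hβ (v k),
      mul_neg, Finset.sum_neg_distrib, neg_eq_zero] at h1
    exact (Finset.sum_congr rfl fun b _ => mul_comm (gram β w v b k) (q b)).trans h1
  subst hq
  simp only [Pi.zero_apply, zero_smul, Finset.sum_const_zero, add_zero]
  exact Submodule.sum_mem _ fun i _ => Submodule.smul_mem _ _ (Submodule.subset_span ⟨i, rfl⟩)

/-- A kernel vector gives a combination of `e` orthogonal to `v`, hence zero; pairing it with `e₁`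
shows that its coefficients vanish. -/
theorem isUnit_gram_of_transversal {e e₁ : Fin m → E} (hg : IsUnit (gram β e₁ e))
    (h : ∀ u ∈ Submodule.span ℝ (range e), (∀ k, β (v k) u = 0) → u = 0) :
    IsUnit (gram β v e) := by
  rw [← Matrix.mulVec_injective_iff_isUnit]
  refine (injective_iff_map_eq_zero (Matrix.mulVecLin _)).mpr fun a ha => ?_
  have h1 : ∑ i, a i • e i = 0 := by
    refine h _ (Submodule.sum_mem _ fun i _ =>
      Submodule.smul_mem _ _ (Submodule.subset_span ⟨i, rfl⟩)) fun k => ?_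
    rw [bilin_sum_smul_right]
    exact (Finset.sum_congr rfl fun b _ => mul_comm _ _).trans (congrFun ha k)
  refine Matrix.mulVec_injective_of_isUnit hg ?_
  rw [Matrix.mulVec_zero]
  funext k
  have h2 := bilin_sum_smul_right β a e (e₁ k)
  rw [h1, map_zero] at h2
  exact (Finset.sum_congr rfl fun b _ => mul_comm (gram β e₁ e k b) (a b)).trans h2.symm

end Maximality

end DynamicPair

namespace DynamicPair
open Set Metric Topology NNReal VectorField Filter

/-! ### The comparison theorem -/

namespace RegularSemiHamiltonianQuadruple

variable {E : Type*} [NormedAddCommGroup E] [NormedSpace ℝ E] [FiniteDimensional ℝ E]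
  {M : Type*} [TopologicalSpace M] [T2Space M] [ChartedSpace E M] [IsManifold 𝓘(ℝ, E) ∞ M]
  {m : ℕ} {Q : RegularSemiHamiltonianQuadruple E M m}

/-- The comparison theorem on the compact interval `[0, π m / √κ]`. -/
theorem exists_isConjugateTime {c : ℝ → M} {κ b : ℝ} (hκ : 0 < κ) (hb : b = Real.pi * m / √κ)
    (hc : IsMIntegralCurveOn c Q.X (Icc 0 b))
    (hdef : ∀ t ∈ Icc 0 b, Q.MetricPosDefAt (c t) ∨ Q.MetricNegDefAt (c t))
    (htr : ∀ t ∈ Icc 0 b, κ ≤ LinearMap.trace ℝ (Q.𝒱 (c t)) (curvature Q.X Q.𝒱 (c t))) :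
    ∃ t ∈ Ioc 0 b, IsConjugateTime Q.X Q.𝒱 c t := by
  have hE : CompleteSpace E := FiniteDimensional.complete ℝ E
  have hb0 : 0 ≤ b := by
    have := Real.pi_pos
    rw [hb]
    positivity
  have h0J : (0 : ℝ) ∈ Icc 0 b := ⟨le_rfl, hb0⟩
  -- In rank zero the trace is `0`, against `κ > 0`.
  have hm : 0 < m := by
    rcases Nat.eq_zero_or_pos m with rfl | h
    · exfalso
      have h1 := hκ.trans_le (htr 0 h0J)
      obtain ⟨U, V, H₀, H₁, -, -, -, -, h2⟩ := Q.exists_frame_curvature h1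
      rw [h2, Matrix.trace, Finset.univ_eq_empty, Finset.sum_empty] at h1
      exact lt_irrefl _ h1
    · exact h
  obtain ⟨P, R, hP0, hPR⟩ := exists_transport Q.smooth_X hc
  have hR0 : ∀ v, R 0 v = v := fun v => by
    have := (hPR 0 h0J).2.2.2.1 v
    rwa [hP0] at this
  have hR : ∀ t ∈ Icc 0 b, ∀ Y U, IsOpen U → c t ∈ U → IsSmoothOn Y U →
      HasDerivWithinAt (fun s => R s (Y (c s))) (R t (bracket Q.X Y (c t))) (Icc 0 b) t :=
    fun t ht => (hPR t ht).2.2.2.2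
  have hinj : ∀ t ∈ Icc 0 b, Function.Injective (R t) := fun t ht =>
    Function.LeftInverse.injective (g := P t) (hPR t ht).2.2.2.1
  have hframe : ∀ t ∈ Icc 0 b, _ := fun t ht => exists_isFrameNear
    hc hR0 hR hinj hdef hκ ht (htr t ht)
  by_contra! hconj
  -- The frame at time `0` provides the basis `v` of `𝒱 (c 0)`.
  obtain ⟨e₀, e₀₁, _, _, _, _, hF₀, -, -, hspan₀⟩ := hframe 0 h0J
  have hiso := hF₀.isotropic.self_of_nhdsWithin h0J
  have hg₀ := isUnit_of_definite (hF₀.definite.self_of_nhdsWithin h0J)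
  have hsp₀ : Submodule.span ℝ (range (e₀ 0)) = Q.planeV (c 0) := by
    rw [hF₀.span.self_of_nhdsWithin h0J]
    ext u
    constructor
    · rintro ⟨z, hz, rfl⟩
      exact (hR0 z).symm ▸ hz
    · exact fun hu => ⟨u, hu, hR0 u⟩
  refine false_of_frames (Λ := fun s => (Q.planeV (c s)).map (R s).toLinearMap) hm hκ
    (Q.form_self (c 0)) hiso hb fun t ht => ?_
  have htJ := Ioc_subset_Icc_self ht
  obtain ⟨e, e₁, e₂, H₀, H₁, H₁', hF, hH, hκt, hspan⟩ := hframe t htJ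
  refine ⟨e, e₁, e₂, H₀, H₁, H₁', hF, hH, hκt, ?_, ?_⟩
  -- A vector of `R t (𝒱 (c t))` orthogonal to `𝒱 (c 0)` lies in `𝒱 (c 0)` by maximality. Its image
  -- under `P t` then lies in both planes at `c t`, so it vanishes when `t` is not conjugate.
  · refine isUnit_gram_of_transversal
      (isUnit_of_definite (hF.definite.self_of_nhdsWithin htJ)) fun u hu huv => ?_
    rw [hF.span.self_of_nhdsWithin htJ] at hu
    obtain ⟨z, hz, rfl⟩ := hu
    have hzD : R t z ∈ Q.planeD (c 0) :=
      transport_mem_planeD hc hR0 hR t htJ z (Q.𝒱_le_𝒟 _ hz)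
    obtain ⟨p, q, hpq⟩ := hspan₀ _ hzD
    have hmem : R t z ∈ Q.planeV (c 0) := by
      rw [← hsp₀, hpq]
      refine mem_span_of_orthogonal (Q.form_self (c 0)) hiso hg₀ fun k => ?_
      rw [← hpq]
      exact huv k
    obtain ⟨hfl, hPd, hRP, hPRt, -⟩ := hPR t htJ
    have hz0 := eq_zero_of_not_isConjugateTime ht.1 hfl hPd (hconj t ht) (R t z) hmem
      (by rw [hPRt]; exact hz)
    rw [hPRt] at hz0
    change R t z = 0
    rw [hz0, map_zero]
  · have hmem : ∀ k, e₀ 0 k ∈ Q.planeD (c 0) := fun k => by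
      have h1 : e₀ 0 k ∈ Q.planeV (c 0) := by
        rw [← hsp₀]; exact Submodule.subset_span ⟨k, rfl⟩
      exact Q.𝒱_le_𝒟 _ h1
    choose p q hpq using fun k => hspan _ (hmem k)
    exact ⟨Matrix.of fun i k => p k i, Matrix.of fun i k => q k i, hpq⟩

end RegularSemiHamiltonianQuadruple

end DynamicPair

theorem mainTheorem5 {E : Type*} [NormedAddCommGroup E] [NormedSpace ℝ E] [FiniteDimensional ℝ E]
    {M : Type*} [TopologicalSpace M] [T2Space M] [ChartedSpace E M] [IsManifold 𝓘(ℝ, E) ∞ M]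
    {m : ℕ} (Q : DynamicPair.RegularSemiHamiltonianQuadruple E M m)
    (T : EReal) (c : ℝ → M)
    (hc : IsMIntegralCurveOn c Q.X {t : ℝ | 0 ≤ t ∧ (t : EReal) < T})
    (hdef : ∀ t : ℝ, 0 ≤ t → (t : EReal) < T →
      Q.MetricPosDefAt (c t) ∨ Q.MetricNegDefAt (c t))
    (κ : ℝ) (hκ : 0 < κ)
    (htr : ∀ t : ℝ, 0 ≤ t → (t : EReal) < T →
      κ ≤ LinearMap.trace ℝ (Q.𝒱 (c t)) (DynamicPair.curvature Q.X Q.𝒱 (c t)))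
    (hT : ((Real.pi * m / √κ : ℝ) : EReal) < T) :
    ∃ t ∈ Set.Ioc 0 (Real.pi * m / √κ), DynamicPair.IsConjugateTime Q.X Q.𝒱 c t := by
  have hlt : ∀ t ∈ Set.Icc 0 (Real.pi * m / √κ), (t : EReal) < T := fun t ht =>
    (EReal.coe_le_coe_iff.mpr ht.2).trans_lt hT
  exact DynamicPair.RegularSemiHamiltonianQuadruple.exists_isConjugateTime hκ rfl
    (hc.mono fun t ht => ⟨ht.1, hlt t ht⟩) (fun t ht => hdef t ht.1 (hlt t ht))
    fun t ht => htr t ht.1 (hlt t ht)
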